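/- Let $n\ge 0$ and let $N$ be a connected complex manifold of complex dimension $n$ with a Kähler form $\omega$ and a holomorphic $(n,0)$-form $\sigma$ which is not identically zero (it is not assumed to be nowhere vanishing). Suppose that there is a holomorphic action of $T^c=(\mathbb{C}^*)^n$ on $N$ such that the action of the real torus $T^n=\{z\in T^c : |z_1|=\dots=|z_n|=1\}$ is effective, preserves $\sigma$, and is Hamiltonian with respect to $\omega$ (it has a $T^n$-invariant smooth moment map $\mu=(\mu_1,\dots,\mu_n):N\to\mathbb{R}^n$, $d\mu_j=\omega(X_j,\cdot)$, where $X_1,\dots,X_n$ are the vector fields generating the action of the circle factors of $T^n$). Then: (1) the $T^c$-action is free, and $N$ is biholomorphic to $T^c$ under the action: for every $p\in N$ the orbit map $T^c\to N$, $z\mapsto z\cdot p$, is a biholomorphism; (2) $\sigma$ vanishes nowhere, and under this identification it is a constant multiple of $\frac{dz_1\wedge\dots\wedge dz_n}{z_1\cdots z_n}$: there is a constant $c\neq 0$ such that for every $p\in N$ the pullback of $\sigma$ by the orbit map $z\mapsto z\cdot p$ equals $c\,\frac{dz_1\wedge\dots\wedge dz_n}{z_1\cdots z_n}$; (3) there is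 $\theta\in\mathbb{R}$ such that the $T^n$-orbits form a special Lagrangian fibration of $(N,\omega,e^{i\theta}\sigma)$: they are exactly the fibres of a smooth locally trivial fibration of $N$ over a real $n$-dimensional manifold, and each orbit $L$ is a (real $n$-dimensional, embedded) submanifold with $\omega|_L=0$ and $\operatorname{Im}(e^{i\theta}\sigma)|_L=0$. -/

import Mathlib

open scoped Manifold ContDiff

noncomputable section

/-- The complex torus `(ℂ^*)ⁿ`, as the (complex Lie) group of units of the ring `ℂⁿ`: an element is
a vector all of whose coordinates are nonzero, and the inclusion into `ℂⁿ` is a global chart. -/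
abbrev ComplexTorus (n : ℕ) : Type := (Fin n → ℂ)ˣ

/-- The real torus `Tⁿ ⊂ (ℂ^*)ⁿ`: all coordinates have absolute value one. -/
def realTorus (n : ℕ) : Subgroup (ComplexTorus n) where
  carrier := {t | ∀ i, ‖(t : Fin n → ℂ) i‖ = 1}
  one_mem' := by intro i; simp
  mul_mem' := by
    intro a b ha hb i
    simp [ha i, hb i]
  inv_mem' := by
    intro a ha i
    have h : (a : Fin n → ℂ) i * ((a⁻¹ : ComplexTorus n) : Fin n → ℂ) i = 1 := by
      exact congrFun a.mul_inv i
    have h2 := congrArg (fun z : ℂ => ‖z‖) h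
    simpa [ha i] using h2

/-- The holomorphic `n`-form `dz₁ ∧ ⋯ ∧ dzₙ / ∏ zᵢ` on `(ℂ^*)ⁿ`. -/
def torusForm (n : ℕ) (z : ComplexTorus n) :
    TangentSpace 𝓘(ℂ, Fin n → ℂ) z [⋀^Fin n]→L[ℂ] ℂ :=
  (∏ i, (z : Fin n → ℂ) i)⁻¹ •
    (show (Fin n → ℂ) [⋀^Fin n]→L[ℂ] ℂ from
      { Matrix.detRowAlternating (R := ℂ) (n := Fin n) with
        cont := Continuous.matrix_det (continuous_id (X := Fin n → Fin n → ℂ)) })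

section Forms

variable {n : ℕ} {N : Type*} [TopologicalSpace N] [ChartedSpace (Fin n → ℂ) N]

/-- A complex-multilinear `n`-form (a form of type `(n,0)`) is holomorphic if its coefficients are
holomorphic in every chart, i.e. if its pullbacks by the inverses of the charts are. -/
def IsHolomorphicForm (σ : ∀ p : N, TangentSpace 𝓘(ℂ, Fin n → ℂ) p [⋀^Fin n]→L[ℂ] ℂ) : Prop :=
  ∀ e ∈ atlas (Fin n → ℂ) N,
    ContDiffOn ℂ ω
      (fun y : Fin n → ℂ => ((σ (e.symm y)).compContinuousLinearMap
        (mfderiv 𝓘(ℂ, Fin n → ℂ) 𝓘(ℂ, Fin n → ℂ) e.symm y) : (Fin n → ℂ) [⋀^Fin n]→L[ℂ] ℂ))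
      e.target

/-- The expression of a real 2-form in the chart `e` (its pullback by the inverse of `e`). -/
def chartForm (κ : ∀ p : N, TangentSpace 𝓘(ℂ, Fin n → ℂ) p [⋀^Fin 2]→L[ℝ] ℝ)
    (e : OpenPartialHomeomorph N (Fin n → ℂ)) (y : Fin n → ℂ) :
    (Fin n → ℂ) [⋀^Fin 2]→L[ℝ] ℝ :=
  (κ (e.symm y)).compContinuousLinearMap
    ((mfderiv 𝓘(ℂ, Fin n → ℂ) 𝓘(ℂ, Fin n → ℂ) e.symm y).restrictScalars ℝ)

/-- A Kähler form: a smooth closed real 2-form which is invariant under the complex structure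
(type `(1,1)`) and positive. -/
structure IsKahlerForm (κ : ∀ p : N, TangentSpace 𝓘(ℂ, Fin n → ℂ) p [⋀^Fin 2]→L[ℝ] ℝ) :
    Prop where
  smooth : ∀ e ∈ atlas (Fin n → ℂ) N, ContDiffOn ℝ ∞ (chartForm κ e) e.target
  closed : ∀ e ∈ atlas (Fin n → ℂ) N, ∀ y ∈ e.target, extDeriv (chartForm κ e) y = 0
  invariant : ∀ (p : N) (v w : TangentSpace 𝓘(ℂ, Fin n → ℂ) p),
    κ p ![Complex.I • v, Complex.I • w] = κ p ![v, w]
  positive : ∀ (p : N) (v : TangentSpace 𝓘(ℂ, Fin n → ℂ) p), v ≠ 0 →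
    0 < κ p ![v, Complex.I • v]

end Forms

section Submanifolds

variable (n : ℕ) {N : Type*} [TopologicalSpace N] [ChartedSpace (Fin n → ℂ) N]

/-- `L` is an embedded real submanifold of `N` of real codimension `k`: near each of its points it
is a level set of a smooth map to `ℝᵏ` with surjective differential. -/
def IsRealSubmanifold (k : ℕ) (L : Set N) : Prop :=
  ∀ p ∈ L, ∃ (U : Set N) (f : N → (Fin k → ℝ)), IsOpen U ∧ p ∈ U ∧
    ContMDiffOn 𝓘(ℝ, Fin n → ℂ) 𝓘(ℝ, Fin k → ℝ) ∞ f U ∧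
    (∀ q ∈ U, Function.Surjective (mfderiv 𝓘(ℝ, Fin n → ℂ) 𝓘(ℝ, Fin k → ℝ) f q)) ∧
    L ∩ U = {q ∈ U | f q = f p}

/-- The tangent vectors of `L` at `p`: the velocities at `p` of the smooth curves inside `L`.
The real and the complex tangent space at a point are the same vector space. -/
def tangentVectors (L : Set N) (p : N) : Set (TangentSpace 𝓘(ℂ, Fin n → ℂ) p) :=
  {v | ∃ γ : ℝ → N, ContMDiff 𝓘(ℝ, ℝ) 𝓘(ℝ, Fin n → ℂ) ∞ γ ∧ γ 0 = p ∧ (∀ t, γ t ∈ L) ∧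
    (mfderiv 𝓘(ℝ, ℝ) 𝓘(ℝ, Fin n → ℂ) γ 0 : ℝ →L[ℝ] (Fin n → ℂ)) 1 = (v : Fin n → ℂ)}

/-- `L` is a special Lagrangian submanifold of `(N, κ, φ)`: a submanifold of half the real dimension
`2n` of `N`, on which `κ` and `Im φ` restrict to zero. -/
structure IsSLag (κ : ∀ p : N, TangentSpace 𝓘(ℂ, Fin n → ℂ) p [⋀^Fin 2]→L[ℝ] ℝ)
    (φ : ∀ p : N, TangentSpace 𝓘(ℂ, Fin n → ℂ) p [⋀^Fin n]→L[ℂ] ℂ) (L : Set N) : Prop where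
  submanifold : IsRealSubmanifold n n L
  lagrangian : ∀ p ∈ L, ∀ v ∈ tangentVectors n L p, ∀ w ∈ tangentVectors n L p, κ p ![v, w] = 0
  special : ∀ p ∈ L, ∀ v : Fin n → TangentSpace 𝓘(ℂ, Fin n → ℂ) p,
    (∀ i, v i ∈ tangentVectors n L p) → (φ p v).im = 0

/-- `π : N → B` is a smooth locally trivial fibration: it is smooth and surjective, and every `b` in
`B` has an open neighbourhood `V` with a smooth `r : π⁻¹(V) → π⁻¹(b)` such that `(π, r)` is a
diffeomorphism `π⁻¹(V) → V × π⁻¹(b)`, with inverse `ψ`. -/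
structure IsSmoothFibration {B : Type*} [TopologicalSpace B] [ChartedSpace (Fin n → ℝ) B]
    (π : N → B) : Prop where
  smooth : ContMDiff 𝓘(ℝ, Fin n → ℂ) 𝓘(ℝ, Fin n → ℝ) ∞ π
  surjective : Function.Surjective π
  locally_trivial : ∀ b : B, ∃ (V : Set B) (r : N → N) (ψ : B × N → N), IsOpen V ∧ b ∈ V ∧
    ContMDiffOn 𝓘(ℝ, Fin n → ℂ) 𝓘(ℝ, Fin n → ℂ) ∞ r (π ⁻¹' V) ∧
    ContMDiffOn (𝓘(ℝ, Fin n → ℝ).prod 𝓘(ℝ, Fin n → ℂ)) 𝓘(ℝ, Fin n → ℂ) ∞ ψ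
      (V ×ˢ (π ⁻¹' {b})) ∧
    (∀ p ∈ π ⁻¹' V, π (r p) = b ∧ ψ (π p, r p) = p) ∧
    (∀ c ∈ V, ∀ q ∈ π ⁻¹' {b}, π (ψ (c, q)) = c ∧ r (ψ (c, q)) = q)

/-- A family `𝓛` of subsets of `N` is a special Lagrangian fibration of `(N, κ, φ)`: its members are
the fibres of a smooth locally trivial fibration of `N` over a real `n`-dimensional manifold, and
they are all special Lagrangian submanifolds. -/
def IsSLagFibration (κ : ∀ p : N, TangentSpace 𝓘(ℂ, Fin n → ℂ) p [⋀^Fin 2]→L[ℝ] ℝ)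
    (φ : ∀ p : N, TangentSpace 𝓘(ℂ, Fin n → ℂ) p [⋀^Fin n]→L[ℂ] ℂ) (𝓛 : Set (Set N)) : Prop :=
  (∃ (B : Type) (_ : TopologicalSpace B) (_ : ChartedSpace (Fin n → ℝ) B) (_ : T2Space B)
    (_ : SecondCountableTopology B) (_ : IsManifold 𝓘(ℝ, Fin n → ℝ) ∞ B) (π : N → B),
    IsSmoothFibration n π ∧ ∀ L : Set N, L ∈ 𝓛 ↔ ∃ b : B, L = π ⁻¹' {b}) ∧
  ∀ L ∈ 𝓛, IsSLag n κ φ L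

end Submanifolds

section Actions

variable {n : ℕ} {N : Type*} [TopologicalSpace N] [ChartedSpace (Fin n → ℂ) N]
  [MulAction (ComplexTorus n) N]

/-- The vector field on `N` induced by the element `ξ` of the Lie algebra `ℂⁿ` of `(ℂ^*)ⁿ`: its
value at `p` is the image of `ξ` under the differential at `1` of the orbit map `z ↦ z • p`. -/
def inducedVectorField (ξ : Fin n → ℂ) (p : N) : TangentSpace 𝓘(ℂ, Fin n → ℂ) p :=
  (mfderiv 𝓘(ℂ, Fin n → ℂ) 𝓘(ℂ, Fin n → ℂ) (fun z : ComplexTorus n => z • p) 1 :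
    (Fin n → ℂ) →L[ℂ] (Fin n → ℂ)) ξ

/-- The real torus preserves the form `σ`: `t^* σ = σ` for all `t` in `Tⁿ`. -/
def PreservesForm (σ : ∀ p : N, TangentSpace 𝓘(ℂ, Fin n → ℂ) p [⋀^Fin n]→L[ℂ] ℂ) : Prop :=
  ∀ t ∈ realTorus n, ∀ p : N,
    (σ (t • p)).compContinuousLinearMap
      (mfderiv 𝓘(ℂ, Fin n → ℂ) 𝓘(ℂ, Fin n → ℂ) (fun q : N => t • q) p) = σ p

/-- `μ` is a moment map for the action of `Tⁿ` on `(N, κ)`, in the basis `(0, …, i, …, 0)` of the Lie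
algebra `i ℝⁿ` of `Tⁿ`: it is smooth, `Tⁿ`-invariant, and `d μ_j = κ(X_j, ·)` for the vector
field `X_j` induced by the `j`-th basis vector. -/
structure IsMomentMap (κ : ∀ p : N, TangentSpace 𝓘(ℂ, Fin n → ℂ) p [⋀^Fin 2]→L[ℝ] ℝ)
    (μ : N → (Fin n → ℝ)) : Prop where
  smooth : ContMDiff 𝓘(ℝ, Fin n → ℂ) 𝓘(ℝ, Fin n → ℝ) ∞ μ
  invariant : ∀ t ∈ realTorus n, ∀ p : N, μ (t • p) = μ p
  deriv_eq : ∀ (p : N) (v : TangentSpace 𝓘(ℂ, Fin n → ℂ) p) (j : Fin n),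
    (mfderiv 𝓘(ℝ, Fin n → ℂ) 𝓘(ℝ, Fin n → ℝ) μ p : (Fin n → ℂ) →L[ℝ] (Fin n → ℝ))
      (v : Fin n → ℂ) j =
    κ p ![inducedVectorField (Pi.single j Complex.I) p, v]

/-- The action of `Tⁿ` is Hamiltonian with respect to `κ`: it has a moment map. (For a closed form
`κ` the invariance of `κ` under `Tⁿ` follows.) -/
def IsHamiltonian (κ : ∀ p : N, TangentSpace 𝓘(ℂ, Fin n → ℂ) p [⋀^Fin 2]→L[ℝ] ℝ) : Prop :=
  ∃ μ : N → (Fin n → ℝ), IsMomentMap κ μ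

end Actions

end

/-!
Let `X₁, …, Xₙ` be the holomorphic vector fields generating the factors of `(ℂ^*)ⁿ`, and let
`f = σ(X₁, …, Xₙ)`, a holomorphic function on `N` (`formCoeff`). The whole theorem follows once `f`
is known to be a nonzero constant.

*The function `f` is constant if it is nonzero somewhere* (`formCoeff_eq`). The real torus preserves
`σ` and, the group being commutative, the `X_j`; so `df` kills the real orbits, and being complex
linear it kills the span of the `X_j`. This span is the whole tangent space where `f ≠ 0`.

*The function `f` does not vanish identically* (`formCoeff_ne_zero`). Otherwise the `X_j` are
dependent at every point of the open set `σ ≠ 0`. The real orbits are isotropic, since the moment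
map is constant on them, hence totally real; so the relations between the `X_j` at a point form the
complexification of a real subspace of `ℂⁿ` (`infAction_re_im_eq_zero`). Near a point where a
maximal independent subfamily is independent, another `X_j` is a combination of it, with
coefficients that are both holomorphic and real, hence constant (`exists_real_vector_of_mem_span`).
So a fixed nonzero real combination of the `X_j` vanishes on an open set, hence everywhere, and a
one-parameter subgroup of the real torus acts trivially, against effectiveness.

*Conclusions.* As `f` is a nonzero constant, the `X_j` form a frame, `σ` vanishes nowhere, and the
orbit maps are local biholomorphisms (`exists_local_log`); as `N` is connected, the action is
transitive. Along a noncompact one-parameter subgroup `exp (τ s)`, with `s` in `ℝⁿ`, the component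
`⟨μ, s⟩` of the moment map is strictly monotone (`IsMomentMap.apply_torusExp_ne`), so stabilizers
lie in the real torus. By transitivity and commutativity they act trivially, so they are trivial.
Under the orbit map of a point the real orbits are the fibres of `z ↦ (log |z₁|, …, log |zₙ|)`,
their tangent spaces are spanned over `ℝ` by the `i`-multiples of the `X_j`, and `σ` takes on them
the values `iⁿ f` times a real determinant.
-/

open Filter Topology

/-! ### From complex to real smoothness -/

section RestrictScalars

variable {E F G : Type*} [NormedAddCommGroup E] [NormedSpace ℂ E] [NormedAddCommGroup F]
  [NormedSpace ℂ F] [NormedAddCommGroup G] [NormedSpace ℂ G]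
  {M M' M'' : Type*} [TopologicalSpace M] [ChartedSpace E M]
  [TopologicalSpace M'] [ChartedSpace F M'] [TopologicalSpace M''] [ChartedSpace G M'']

/-- The real and the complex manifold structure have the same charts, so a holomorphic map is smooth
as a map of real manifolds. -/
theorem ContMDiffAt.complexToReal {f : M → M'} {x : M}
    (hf : ContMDiffAt 𝓘(ℂ, E) 𝓘(ℂ, F) ω f x) : ContMDiffAt 𝓘(ℝ, E) 𝓘(ℝ, F) ∞ f x := by
  rw [contMDiffAt_iff] at hf ⊢
  exact ⟨hf.1, (hf.2.restrict_scalars ℝ).of_le le_top⟩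

theorem ContMDiff.complexToReal {f : M → M'}
    (hf : ContMDiff 𝓘(ℂ, E) 𝓘(ℂ, F) ω f) : ContMDiff 𝓘(ℝ, E) 𝓘(ℝ, F) ∞ f :=
  fun x => (hf x).complexToReal

theorem ContMDiff.complexToReal_prod {f : M × M' → M''}
    (hf : ContMDiff (𝓘(ℂ, E).prod 𝓘(ℂ, F)) 𝓘(ℂ, G) ω f) :
    ContMDiff (𝓘(ℝ, E).prod 𝓘(ℝ, F)) 𝓘(ℝ, G) ∞ f := by
  intro x
  have hx := hf x
  rw [contMDiffAt_iff] at hx ⊢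
  exact ⟨hx.1, (hx.2.restrict_scalars ℝ).of_le le_top⟩

theorem HasMFDerivAt.complexToReal {f : M → M'} {x : M} {f' : E →L[ℂ] F}
    (hf : HasMFDerivAt 𝓘(ℂ, E) 𝓘(ℂ, F) f x f') :
    HasMFDerivAt 𝓘(ℝ, E) 𝓘(ℝ, F) f x (f'.restrictScalars ℝ : E →L[ℝ] F) :=
  ⟨hf.1, HasFDerivWithinAt.restrictScalars ℝ hf.2⟩

end RestrictScalars

/-! ### Manifold derivatives as maps between model spaces -/

section ModelDeriv

variable {𝕜 : Type*} [NontriviallyNormedField 𝕜] {E F G : Type*} [NormedAddCommGroup E]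
  [NormedSpace 𝕜 E] [NormedAddCommGroup F] [NormedSpace 𝕜 F] [NormedAddCommGroup G]
  [NormedSpace 𝕜 G] {M M' M'' : Type*} [TopologicalSpace M] [ChartedSpace E M]
  [TopologicalSpace M'] [ChartedSpace F M'] [TopologicalSpace M''] [ChartedSpace G M'']

variable (𝕜) in
/-- The manifold derivative of a map between manifolds without boundary, as a map between the model
spaces, to which the tangent spaces are definitionally equal. -/
noncomputable def modelDeriv (f : M → M') (x : M) : E →L[𝕜] F :=
  (mfderiv 𝓘(𝕜, E) 𝓘(𝕜, F) f x :)

theorem MDifferentiableAt.hasMFDerivAt_modelDeriv {f : M → M'} {x : M}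
    (hf : MDifferentiableAt 𝓘(𝕜, E) 𝓘(𝕜, F) f x) :
    HasMFDerivAt 𝓘(𝕜, E) 𝓘(𝕜, F) f x (modelDeriv 𝕜 f x : E →L[𝕜] F) :=
  hf.hasMFDerivAt

/-- The chain rule with all derivatives written as maps between the model spaces. -/
theorem HasMFDerivAt.comp_model {f : M → M'} {g : M' → M''} {k : M → M''} {x : M} {y : M'}
    {f' : E →L[𝕜] F} {g' : F →L[𝕜] G} (hg : HasMFDerivAt 𝓘(𝕜, F) 𝓘(𝕜, G) g y g')
    (hf : HasMFDerivAt 𝓘(𝕜, E) 𝓘(𝕜, F) f x f') (hy : f x = y) (hk : ∀ x, g (f x) = k x) :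
    HasMFDerivAt 𝓘(𝕜, E) 𝓘(𝕜, G) k x (g' ∘L f') := by
  subst hy
  obtain rfl : g ∘ f = k := funext hk
  exact HasMFDerivAt.comp x hg hf

theorem HasMFDerivAt.unique_model {f g : M → M'} {x : M} {f' g' : E →L[𝕜] F}
    (hf : HasMFDerivAt 𝓘(𝕜, E) 𝓘(𝕜, F) f x f') (hg : HasMFDerivAt 𝓘(𝕜, E) 𝓘(𝕜, F) g x g')
    (hfg : ∀ x, f x = g x) : f' = g' := by
  obtain rfl : f = g := funext hfg
  exact hasMFDerivAt_unique hf hg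

theorem HasMFDerivAt.modelDeriv_eq {f : M → M'} {x : M} {f' : E →L[𝕜] F}
    (hf : HasMFDerivAt 𝓘(𝕜, E) 𝓘(𝕜, F) f x f') : modelDeriv 𝕜 f x = f' :=
  hf.mfderiv

theorem HasMFDerivAt.hasFDerivAt_model {f : E → F} {x : E} {f' : E →L[𝕜] F}
    (hf : HasMFDerivAt 𝓘(𝕜, E) 𝓘(𝕜, F) f x f') : HasFDerivAt f f' x :=
  hasMFDerivAt_iff_hasFDerivAt.1 hf

theorem HasMFDerivAt.congr_model {f : M → M'} {x : M} {f' g' : E →L[𝕜] F}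
    (hf : HasMFDerivAt 𝓘(𝕜, E) 𝓘(𝕜, F) f x f') (h : f' = g') :
    HasMFDerivAt 𝓘(𝕜, E) 𝓘(𝕜, F) f x g' :=
  h ▸ hf

end ModelDeriv

/-! ### Maps with vanishing derivative -/

section LocallyConstant

variable {E F : Type*} [NormedAddCommGroup E] [NormedSpace ℂ E]
  [NormedAddCommGroup F] [NormedSpace ℂ F] {M M' : Type*} [TopologicalSpace M] [ChartedSpace E M]
  [IsManifold 𝓘(ℂ, E) 1 M] [TopologicalSpace M'] [ChartedSpace F M'] [IsManifold 𝓘(ℂ, F) 1 M']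

/-- A map with vanishing derivative near a point is constant near that point. -/
theorem eventually_eq_of_hasMFDerivAt_zero {f : M → M'} {x : M}
    (hf : ∀ᶠ y in 𝓝 x, HasMFDerivAt 𝓘(ℂ, E) 𝓘(ℂ, F) f y 0) : ∀ᶠ y in 𝓝 x, f y = f x := by
  have hc : ContinuousAt f x := hf.self_of_nhds.1
  set e := chartAt E x
  set e' := chartAt F (f x)
  have hev : ∀ᶠ y in 𝓝 x, HasMFDerivAt 𝓘(ℂ, E) 𝓘(ℂ, F) f y 0 ∧ f y ∈ e'.source :=
    hf.and (hc.eventually (e'.open_source.mem_nhds (mem_chart_source F (f x))))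
  have hx : x ∈ e.source := mem_chart_source E x
  have hev' : ∀ᶠ u in 𝓝 (e x), u ∈ e.target ∧
      HasMFDerivAt 𝓘(ℂ, E) 𝓘(ℂ, F) f (e.symm u) 0 ∧ f (e.symm u) ∈ e'.source := by
    refine (e.open_target.eventually_mem (e.map_source hx)).and ?_
    exact (e.continuousAt_symm (e.map_source hx)).eventually (by rwa [e.left_inv hx])
  obtain ⟨r, hr, hball⟩ := Metric.eventually_nhds_iff_ball.1 hev'
  have hd : ∀ u ∈ Metric.ball (e x) r,
      HasFDerivAt (fun u => e' (f (e.symm u))) (0 : E →L[ℂ] F) u := by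
    intro u hu
    obtain ⟨h1, h2, h3⟩ := hball u hu
    have a1 := (mdifferentiableAt_atlas_symm (I := 𝓘(ℂ, E)) (chart_mem_atlas E x) h1).hasMFDerivAt
    have a2 := (mdifferentiableAt_atlas (I := 𝓘(ℂ, F)) (chart_mem_atlas F (f x)) h3).hasMFDerivAt
    have a3 := a2.comp u (h2.comp u a1)
    rw [ContinuousLinearMap.zero_comp, ContinuousLinearMap.comp_zero] at a3
    exact a3.hasFDerivAt
  have hconst : ∀ u ∈ Metric.ball (e x) r, e' (f (e.symm u)) = e' (f x) := by
    intro u hu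
    have := Metric.isOpen_ball.is_const_of_fderiv_eq_zero (𝕜 := ℂ)
      (convex_ball (e x) r).isPreconnected
      (fun u hu => (hd u hu).differentiableAt.differentiableWithinAt)
      (fun u hu => (hd u hu).fderiv) hu (Metric.mem_ball_self hr)
    simpa [e.left_inv hx] using this
  have : ∀ᶠ y in 𝓝 x, y ∈ e.source ∧ e y ∈ Metric.ball (e x) r :=
    (e.open_source.eventually_mem hx).and
      ((e.continuousAt hx).eventually (Metric.ball_mem_nhds _ hr))
  filter_upwards [this] with y hy
  have h := hconst (e y) hy.2
  have h3 := (hball (e y) hy.2).2.2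
  rw [e.left_inv hy.1] at h h3
  exact e'.injOn h3 (mem_chart_source F (f x)) h

theorem eq_of_hasMFDerivAt_zero [PreconnectedSpace M] [T2Space M'] {f : M → M'}
    (hf : ∀ y, HasMFDerivAt 𝓘(ℂ, E) 𝓘(ℂ, F) f y 0) (x y : M) : f x = f y := by
  have : IsLocallyConstant f := by
    rw [IsLocallyConstant.iff_eventually_eq]
    exact fun x => eventually_eq_of_hasMFDerivAt_zero (Eventually.of_forall hf)
  exact this.apply_eq_of_isPreconnected isPreconnected_univ trivial trivial

end LocallyConstant

/-! ### The exponential map of the complex torus -/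

section TorusExp

variable {n : ℕ}

/-- The exponential map `ℂⁿ → (ℂ^*)ⁿ` of the complex torus, coordinatewise `exp`. -/
noncomputable def torusExp (w : Fin n → ℂ) : ComplexTorus n where
  val i := Complex.exp (w i)
  inv i := Complex.exp (-w i)
  val_inv := by ext i; simp [← Complex.exp_add]
  inv_val := by ext i; simp [← Complex.exp_add]

@[simp] theorem torusExp_apply (w : Fin n → ℂ) (i : Fin n) :
    (torusExp w : Fin n → ℂ) i = Complex.exp (w i) := rfl

@[simp] theorem torusExp_zero : torusExp (0 : Fin n → ℂ) = 1 := by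
  ext i; simp

theorem torusExp_add (v w : Fin n → ℂ) : torusExp (v + w) = torusExp v * torusExp w := by
  ext i; simp [Complex.exp_add]

theorem ComplexTorus.apply_ne_zero (z : ComplexTorus n) (i : Fin n) : (z : Fin n → ℂ) i ≠ 0 :=
  (Pi.isUnit_iff.1 z.isUnit i).ne_zero

theorem torusExp_surjective : Function.Surjective (torusExp (n := n)) := by
  intro z
  refine ⟨fun i => Complex.log ((z : Fin n → ℂ) i), ?_⟩
  ext i
  simp [Complex.exp_log (z.apply_ne_zero i)]

theorem torusExp_mem_realTorus_iff {w : Fin n → ℂ} :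
    torusExp w ∈ realTorus n ↔ ∀ i, (w i).re = 0 := by
  change (∀ i, ‖Complex.exp (w i)‖ = 1) ↔ _
  simp [Complex.norm_exp]

theorem contMDiff_torusExp :
    ContMDiff 𝓘(ℂ, Fin n → ℂ) 𝓘(ℂ, Fin n → ℂ) ω (torusExp (n := n)) := by
  apply ContMDiff.of_comp_isOpenEmbedding Units.isOpenEmbedding_val
  rw [contMDiff_iff_contDiff, contDiff_pi]
  intro i
  exact Complex.contDiff_exp.comp (contDiff_apply ℂ ℂ i)

/-- In the chart given by the inclusion `(ℂ^*)ⁿ ⊂ ℂⁿ`, the derivative of the exponential map is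
multiplication by its value. -/
theorem hasMFDerivAt_torusExp (w : Fin n → ℂ) :
    HasMFDerivAt 𝓘(ℂ, Fin n → ℂ) 𝓘(ℂ, Fin n → ℂ) torusExp w
      (ContinuousLinearMap.mul ℂ (Fin n → ℂ) (torusExp w : Fin n → ℂ)) := by
  refine ⟨contMDiff_torusExp.continuous.continuousAt, HasFDerivAt.hasFDerivWithinAt ?_⟩
  have h : HasFDerivAt (fun w : Fin n → ℂ => (torusExp w : Fin n → ℂ))
      (ContinuousLinearMap.mul ℂ (Fin n → ℂ) (torusExp w : Fin n → ℂ)) w := by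
    rw [hasFDerivAt_pi']
    intro i
    refine ((Complex.hasDerivAt_exp (w i)).comp_hasFDerivAt w
      (hasFDerivAt_apply i w)).congr_fderiv ?_
    ext v
    simp
  exact h

end TorusExp

/-! ### The infinitesimal action -/

section InfinitesimalAction

theorem modelDeriv_symm_comp {n : ℕ} {N : Type*} [TopologicalSpace N]
    [ChartedSpace (Fin n → ℂ) N] [IsManifold 𝓘(ℂ, Fin n → ℂ) ω N]
    {e : OpenPartialHomeomorph N (Fin n → ℂ)}
    (he : e ∈ atlas (Fin n → ℂ) N) {p : N} (hp : p ∈ e.source) :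
    (modelDeriv ℂ e.symm (e p) : (Fin n → ℂ) →L[ℂ] (Fin n → ℂ)) ∘L
      (modelDeriv ℂ e p : (Fin n → ℂ) →L[ℂ] (Fin n → ℂ)) = ContinuousLinearMap.id ℂ (Fin n → ℂ) :=
  (mdifferentiable_of_mem_atlas (I := 𝓘(ℂ, Fin n → ℂ)) he).symm_comp_deriv hp

variable {n : ℕ} {N : Type*} [TopologicalSpace N] [ChartedSpace (Fin n → ℂ) N]
  [MulAction (ComplexTorus n) N]

/-- The infinitesimal action `ℂⁿ → T_p N`: the differential at `0` of `w ↦ torusExp w • p`. The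
tangent space is written as the model space `ℂⁿ`, which it is by definition. -/
noncomputable def infAction (p : N) : (Fin n → ℂ) →L[ℂ] (Fin n → ℂ) :=
  modelDeriv ℂ (fun w : Fin n → ℂ => torusExp w • p) 0

/-- The expression of the infinitesimal action in the chart `e`, at the point `y` of the target. -/
noncomputable def chartInfAction (e : OpenPartialHomeomorph N (Fin n → ℂ)) (y : Fin n → ℂ) :
    (Fin n → ℂ) →L[ℂ] (Fin n → ℂ) :=
  fderiv ℂ (fun w : Fin n → ℂ => e (torusExp w • e.symm y)) 0

variable [ContMDiffSMul 𝓘(ℂ, Fin n → ℂ) 𝓘(ℂ, Fin n → ℂ) ω (ComplexTorus n) N]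

theorem contMDiff_torusExp_smul :
    ContMDiff (𝓘(ℂ, Fin n → ℂ).prod 𝓘(ℂ, Fin n → ℂ)) 𝓘(ℂ, Fin n → ℂ) ω
      (fun x : (Fin n → ℂ) × N => torusExp x.1 • x.2) :=
  (contMDiff_torusExp.comp contMDiff_fst).smul contMDiff_snd

theorem contMDiff_orbitMap (p : N) :
    ContMDiff 𝓘(ℂ, Fin n → ℂ) 𝓘(ℂ, Fin n → ℂ) ω (fun z : ComplexTorus n => z • p) :=
  ContMDiff.smul (I := 𝓘(ℂ, Fin n → ℂ)) contMDiff_id contMDiff_const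

theorem contMDiff_expOrbitMap (p : N) :
    ContMDiff 𝓘(ℂ, Fin n → ℂ) 𝓘(ℂ, Fin n → ℂ) ω (fun w : Fin n → ℂ => torusExp w • p) :=
  (contMDiff_orbitMap p).comp contMDiff_torusExp

theorem contMDiff_smul_left (z : ComplexTorus n) :
    ContMDiff 𝓘(ℂ, Fin n → ℂ) 𝓘(ℂ, Fin n → ℂ) ω (fun p : N => z • p) :=
  ContMDiffSMul.contMDiff_const_smul (I := 𝓘(ℂ, Fin n → ℂ)) z

theorem hasMFDerivAt_expOrbitMap_zero (p : N) :
    HasMFDerivAt 𝓘(ℂ, Fin n → ℂ) 𝓘(ℂ, Fin n → ℂ) (fun w : Fin n → ℂ => torusExp w • p) 0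
      (infAction p) :=
  ((contMDiff_expOrbitMap p).mdifferentiable (by simp) 0).hasMFDerivAt

theorem hasMFDerivAt_expOrbitMap (p : N) (w : Fin n → ℂ) :
    HasMFDerivAt 𝓘(ℂ, Fin n → ℂ) 𝓘(ℂ, Fin n → ℂ) (fun w : Fin n → ℂ => torusExp w • p) w
      (infAction (torusExp w • p)) := by
  have h1 : HasMFDerivAt 𝓘(ℂ, Fin n → ℂ) 𝓘(ℂ, Fin n → ℂ) (fun v : Fin n → ℂ => v - w) w
      (ContinuousLinearMap.id ℂ (Fin n → ℂ)) :=
    ((hasFDerivAt_id w).sub_const w).hasMFDerivAt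
  have h2 : HasMFDerivAt 𝓘(ℂ, Fin n → ℂ) 𝓘(ℂ, Fin n → ℂ)
      (fun v : Fin n → ℂ => torusExp v • torusExp w • p) 0 (infAction (torusExp w • p)) :=
     hasMFDerivAt_expOrbitMap_zero (torusExp w • p)
  have h3 := h2.comp_model h1 (k := fun v => torusExp v • p) (sub_self w)
    (fun v => by rw [smul_smul, ← torusExp_add, sub_add_cancel])
  exact h3.congr_model (ContinuousLinearMap.comp_id _)

/-- The infinitesimal action is invariant under the group, which is commutative. -/
theorem infAction_smul (z : ComplexTorus n) (p : N) :
    infAction (z • p) =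
      (modelDeriv ℂ (fun q : N => z • q) p : (Fin n → ℂ) →L[ℂ] (Fin n → ℂ)) ∘L infAction p := by
  have h2 := ((contMDiff_smul_left z).mdifferentiable (by simp) p).hasMFDerivAt_modelDeriv
  have h3 := h2.comp_model (hasMFDerivAt_expOrbitMap_zero p) (k := fun w => z • torusExp w • p)
    (by rw [torusExp_zero, one_smul]) (fun w => rfl)
  exact (hasMFDerivAt_expOrbitMap_zero (z • p)).unique_model h3 (fun w => smul_comm _ _ _)

/-- In the coordinates of `(ℂ^*)ⁿ ⊂ ℂⁿ` the derivative of an orbit map at `z` is `v ↦ X_{v / z}`. -/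
theorem hasMFDerivAt_orbitMap (z : ComplexTorus n) (p : N) :
    HasMFDerivAt 𝓘(ℂ, Fin n → ℂ) 𝓘(ℂ, Fin n → ℂ) (fun z : ComplexTorus n => z • p) z
      (infAction (z • p) ∘L
        ContinuousLinearMap.mul ℂ (Fin n → ℂ) ((z⁻¹ : ComplexTorus n) : Fin n → ℂ)) := by
  obtain ⟨w, rfl⟩ := torusExp_surjective z
  have h1 := ((contMDiff_orbitMap p).mdifferentiable (by simp) (torusExp w)).hasMFDerivAt_modelDeriv
  have h3 := (hasMFDerivAt_expOrbitMap p w).unique_model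
    (h1.comp_model (hasMFDerivAt_torusExp w) rfl fun _ => rfl) fun _ => rfl
  have h5 : (modelDeriv ℂ (fun z : ComplexTorus n => z • p) (torusExp w) :
      (Fin n → ℂ) →L[ℂ] (Fin n → ℂ)) = infAction (torusExp w • p) ∘L
        ContinuousLinearMap.mul ℂ (Fin n → ℂ) (((torusExp w)⁻¹ : ComplexTorus n) : Fin n → ℂ) := by
    rw [h3]
    refine ContinuousLinearMap.ext fun v => ?_
    change _ = (modelDeriv ℂ (fun z : ComplexTorus n => z • p) (torusExp w) :
      (Fin n → ℂ) →L[ℂ] (Fin n → ℂ)) (_ * (_ * v))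
    rw [Units.mul_inv_cancel_left]
  exact h1.congr_model h5

theorem inducedVectorField_eq (ξ : Fin n → ℂ) (p : N) :
    (inducedVectorField ξ p : Fin n → ℂ) = infAction p ξ := by
  have h : (modelDeriv ℂ (fun z : ComplexTorus n => z • p) 1 : (Fin n → ℂ) →L[ℂ] (Fin n → ℂ)) =
      infAction p := by
    rw [(hasMFDerivAt_orbitMap (1 : ComplexTorus n) p).modelDeriv_eq, one_smul]
    refine ContinuousLinearMap.ext fun (v : Fin n → ℂ) => ?_
    change infAction p ((((1 : ComplexTorus n)⁻¹ : ComplexTorus n) : Fin n → ℂ) * v) =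
      infAction p v
    rw [inv_one, Units.val_one, one_mul]
  exact congrArg (fun L : (Fin n → ℂ) →L[ℂ] (Fin n → ℂ) => L ξ) h

theorem contDiffAt_chart_torusExp_smul [IsManifold 𝓘(ℂ, Fin n → ℂ) ω N]
    {e : OpenPartialHomeomorph N (Fin n → ℂ)}
    (he : e ∈ atlas (Fin n → ℂ) N) {y : Fin n → ℂ} (hy : y ∈ e.target) :
    ContDiffAt ℂ ω (fun x : (Fin n → ℂ) × (Fin n → ℂ) => e (torusExp x.2 • e.symm x.1)) (y, 0) := by
  rw [← contMDiffAt_iff_contDiffAt]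
  have he' := IsManifold.subset_maximalAtlas (I := 𝓘(ℂ, Fin n → ℂ)) (n := ω) he
  have h1 : ContMDiffAt 𝓘(ℂ, Fin n → ℂ) 𝓘(ℂ, Fin n → ℂ) ω e.symm y :=
    contMDiffAt_symm_of_mem_maximalAtlas he' hy
  have h2 : ContMDiffAt 𝓘(ℂ, Fin n → ℂ) 𝓘(ℂ, Fin n → ℂ) ω e
      (torusExp (0 : Fin n → ℂ) • e.symm y) := by
    rw [torusExp_zero, one_smul]
    exact contMDiffAt_of_mem_maximalAtlas he' (e.map_target hy)
  have hfst : ContMDiffAt 𝓘(ℂ, (Fin n → ℂ) × (Fin n → ℂ)) 𝓘(ℂ, Fin n → ℂ) ω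
      (Prod.fst : (Fin n → ℂ) × (Fin n → ℂ) → (Fin n → ℂ)) (y, 0) := contDiffAt_fst.contMDiffAt
  have hsnd : ContMDiffAt 𝓘(ℂ, (Fin n → ℂ) × (Fin n → ℂ)) 𝓘(ℂ, Fin n → ℂ) ω
      (Prod.snd : (Fin n → ℂ) × (Fin n → ℂ) → (Fin n → ℂ)) (y, 0) := contDiffAt_snd.contMDiffAt
  have h3 : ContMDiffAt 𝓘(ℂ, (Fin n → ℂ) × (Fin n → ℂ)) 𝓘(ℂ, Fin n → ℂ) ω
      (fun x : (Fin n → ℂ) × (Fin n → ℂ) => torusExp x.2 • e.symm x.1) (y, 0) :=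
    ContMDiffAt.smul (I := 𝓘(ℂ, Fin n → ℂ)) (contMDiff_torusExp.contMDiffAt.comp _ hsnd)
      (ContMDiffAt.comp (y, (0 : Fin n → ℂ)) h1 hfst)
  exact ContMDiffAt.comp (y, (0 : Fin n → ℂ)) h2 h3

theorem contDiffAt_chartInfAction [IsManifold 𝓘(ℂ, Fin n → ℂ) ω N]
    {e : OpenPartialHomeomorph N (Fin n → ℂ)}
    (he : e ∈ atlas (Fin n → ℂ) N) {y : Fin n → ℂ} (hy : y ∈ e.target) :
    ContDiffAt ℂ ω (chartInfAction (n := n) e) y :=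
  ContDiffAt.fderiv (f := fun (y w : Fin n → ℂ) => e (torusExp w • e.symm y))
    (g := fun _ => 0) (contDiffAt_chart_torusExp_smul he hy) contDiffAt_const le_top

theorem chartInfAction_eq [IsManifold 𝓘(ℂ, Fin n → ℂ) ω N]
    {e : OpenPartialHomeomorph N (Fin n → ℂ)}
    (he : e ∈ atlas (Fin n → ℂ) N) {p : N} (hp : p ∈ e.source) :
    chartInfAction e (e p) =
      (modelDeriv ℂ e p : (Fin n → ℂ) →L[ℂ] (Fin n → ℂ)) ∘L infAction p := by
  have h2 := (mdifferentiableAt_atlas (I := 𝓘(ℂ, Fin n → ℂ)) he hp).hasMFDerivAt_modelDeriv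
  have h3 := h2.comp_model (hasMFDerivAt_expOrbitMap_zero p) (by rw [torusExp_zero, one_smul]) (fun _ => rfl)
  rw [chartInfAction, e.left_inv hp]
  exact h3.hasFDerivAt_model.fderiv

theorem infAction_eq_chart [IsManifold 𝓘(ℂ, Fin n → ℂ) ω N]
    {e : OpenPartialHomeomorph N (Fin n → ℂ)}
    (he : e ∈ atlas (Fin n → ℂ) N) {p : N} (hp : p ∈ e.source) :
    infAction p = (modelDeriv ℂ e.symm (e p) : (Fin n → ℂ) →L[ℂ] (Fin n → ℂ)) ∘L
      chartInfAction e (e p) := by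
  rw [chartInfAction_eq he hp, ← ContinuousLinearMap.comp_assoc, modelDeriv_symm_comp he hp,
    ContinuousLinearMap.id_comp]

theorem chartInfAction_apply_eq_zero_iff [IsManifold 𝓘(ℂ, Fin n → ℂ) ω N]
    {e : OpenPartialHomeomorph N (Fin n → ℂ)}
    (he : e ∈ atlas (Fin n → ℂ) N) {p : N} (hp : p ∈ e.source) (ξ : Fin n → ℂ) :
    chartInfAction e (e p) ξ = 0 ↔ infAction p ξ = 0 := by
  constructor
  · intro h
    rw [infAction_eq_chart he hp, ContinuousLinearMap.comp_apply, h, map_zero]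
  · intro h
    rw [chartInfAction_eq he hp, ContinuousLinearMap.comp_apply, h, map_zero]

end InfinitesimalAction

/-! ### The coefficient of the holomorphic form -/

section FormCoefficient

variable {n : ℕ} {N : Type*} [TopologicalSpace N] [ChartedSpace (Fin n → ℂ) N]
  [MulAction (ComplexTorus n) N]

/-- The function `σ(X₁, …, Xₙ)`, where `X_j` is the holomorphic vector field generating the `j`-th
factor of `(ℂ^*)ⁿ`. -/
noncomputable def formCoeff (σ : ∀ p : N, TangentSpace 𝓘(ℂ, Fin n → ℂ) p [⋀^Fin n]→L[ℂ] ℂ)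
    (p : N) : ℂ :=
  (σ p : (Fin n → ℂ) [⋀^Fin n]→L[ℂ] ℂ) fun i => infAction p (Pi.single i 1)

theorem clm_apply_eq_sum_single {F : Type*} [NormedAddCommGroup F] [NormedSpace ℂ F]
    (A : (Fin n → ℂ) →L[ℂ] F) (ξ : Fin n → ℂ) : A ξ = ∑ i, ξ i • A (Pi.single i 1) := by
  conv_lhs => rw [pi_eq_sum_univ' ξ]
  simp only [map_sum, map_smul]

theorem infAction_injective_of_formCoeff_ne_zero
    {σ : ∀ p : N, TangentSpace 𝓘(ℂ, Fin n → ℂ) p [⋀^Fin n]→L[ℂ] ℂ} {p : N}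
    (h : formCoeff σ p ≠ 0) : Function.Injective (infAction (n := n) p) := by
  have hli : LinearIndependent ℂ fun i : Fin n => infAction (n := n) p (Pi.single i 1) := by
    by_contra hli
    exact h (AlternatingMap.map_linearDependent
      (σ p : (Fin n → ℂ) [⋀^Fin n]→L[ℂ] ℂ).toAlternatingMap _ hli)
  rw [injective_iff_map_eq_zero]
  intro ξ hξ
  rw [clm_apply_eq_sum_single] at hξ
  exact funext (Fintype.linearIndependent_iff.1 hli ξ hξ)

theorem ne_zero_of_formCoeff_ne_zero
    {σ : ∀ p : N, TangentSpace 𝓘(ℂ, Fin n → ℂ) p [⋀^Fin n]→L[ℂ] ℂ} {p : N}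
    (h : formCoeff σ p ≠ 0) : σ p ≠ 0 := by
  rintro h0
  apply h
  rw [formCoeff, h0]
  rfl

theorem infAction_surjective_of_injective {p : N} (h : Function.Injective (infAction (n := n) p)) :
    Function.Surjective (infAction (n := n) p) :=
  LinearMap.injective_iff_surjective
    (f := ((infAction (n := n) p : (Fin n → ℂ) →L[ℂ] (Fin n → ℂ)) :
      (Fin n → ℂ) →ₗ[ℂ] (Fin n → ℂ))).1 h

variable [ContMDiffSMul 𝓘(ℂ, Fin n → ℂ) 𝓘(ℂ, Fin n → ℂ) ω (ComplexTorus n) N]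

theorem formCoeff_smul_of_mem_realTorus
    {σ : ∀ p : N, TangentSpace 𝓘(ℂ, Fin n → ℂ) p [⋀^Fin n]→L[ℂ] ℂ} (hpres : PreservesForm σ)
    {t : ComplexTorus n} (ht : t ∈ realTorus n) (p : N) : formCoeff σ (t • p) = formCoeff σ p := by
  have h : (σ (t • p) : (Fin n → ℂ) [⋀^Fin n]→L[ℂ] ℂ).compContinuousLinearMap
      (modelDeriv ℂ (fun q : N => t • q) p : (Fin n → ℂ) →L[ℂ] (Fin n → ℂ)) = σ p := hpres t ht p
  have h' := congrArg (fun φ : (Fin n → ℂ) [⋀^Fin n]→L[ℂ] ℂ =>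
    φ fun i => infAction p (Pi.single i 1)) h
  refine Eq.trans ?_ h'
  rw [formCoeff, infAction_smul]
  rfl

variable [IsManifold 𝓘(ℂ, Fin n → ℂ) ω N]

theorem hasMFDerivAt_formCoeff {σ : ∀ p : N, TangentSpace 𝓘(ℂ, Fin n → ℂ) p [⋀^Fin n]→L[ℂ] ℂ}
    (hσ : IsHolomorphicForm σ) (p : N) :
    HasMFDerivAt 𝓘(ℂ, Fin n → ℂ) 𝓘(ℂ, ℂ) (formCoeff σ) p
      (modelDeriv ℂ (formCoeff σ) p : (Fin n → ℂ) →L[ℂ] ℂ) := by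
  apply MDifferentiableAt.hasMFDerivAt_modelDeriv
  set e := chartAt (Fin n → ℂ) p
  have he : e ∈ atlas (Fin n → ℂ) N := chart_mem_atlas _ p
  have hp : p ∈ e.source := mem_chart_source _ p
  let S : (Fin n → ℂ) → (Fin n → ℂ) [⋀^Fin n]→L[ℂ] ℂ := fun y =>
    (σ (e.symm y) : (Fin n → ℂ) [⋀^Fin n]→L[ℂ] ℂ).compContinuousLinearMap
      (modelDeriv ℂ e.symm y : (Fin n → ℂ) →L[ℂ] (Fin n → ℂ))
  have hS : DifferentiableAt ℂ S (e p) :=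
    ((hσ e he).contDiffAt (e.open_target.mem_nhds (e.map_source hp))).differentiableAt (by simp)
  have hA : DifferentiableAt ℂ (chartInfAction (N := N) e) (e p) :=
    (contDiffAt_chartInfAction he (e.map_source hp)).differentiableAt (by simp)
  have hg : DifferentiableAt ℂ (fun y => S y fun i => chartInfAction e y (Pi.single i 1)) (e p) :=
    (hS.hasFDerivAt.continuousAlternatingMap_apply fun i =>
      ((hA.clm_apply (differentiableAt_const (Pi.single i (1 : ℂ)))).hasFDerivAt)).differentiableAt
  have hcomp := MDifferentiableAt.comp p hg.mdifferentiableAt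
    (mdifferentiableAt_atlas (I := 𝓘(ℂ, Fin n → ℂ)) he hp)
  refine hcomp.congr_of_eventuallyEq ?_
  filter_upwards [e.open_source.mem_nhds hp] with q hq
  change formCoeff σ q = (σ (e.symm (e q)) : (Fin n → ℂ) [⋀^Fin n]→L[ℂ] ℂ) fun i =>
    (modelDeriv ℂ e.symm (e q) : (Fin n → ℂ) →L[ℂ] (Fin n → ℂ))
      (chartInfAction e (e q) (Pi.single i 1))
  rw [formCoeff, infAction_eq_chart he hq, e.left_inv hq]
  rfl

/-- The coefficient is constant along the orbits of the real torus, so its differential kills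
`i ℝⁿ`, and being complex linear it kills all of `ℂⁿ`. -/
theorem modelDeriv_formCoeff_comp_infAction
    {σ : ∀ p : N, TangentSpace 𝓘(ℂ, Fin n → ℂ) p [⋀^Fin n]→L[ℂ] ℂ}
    (hσ : IsHolomorphicForm σ) (hpres : PreservesForm σ) (p : N) (ξ : Fin n → ℂ) :
    (modelDeriv ℂ (formCoeff σ) p : (Fin n → ℂ) →L[ℂ] ℂ) (infAction p ξ) = 0 := by
  have h1 := ((hasMFDerivAt_formCoeff hσ p).comp_model (hasMFDerivAt_expOrbitMap_zero p)
    (by rw [torusExp_zero, one_smul]) fun _ => rfl).hasFDerivAt_model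
  set D : (Fin n → ℂ) →L[ℂ] ℂ :=
    (modelDeriv ℂ (formCoeff σ) p : (Fin n → ℂ) →L[ℂ] ℂ) ∘L infAction p
  change D ξ = 0
  rw [clm_apply_eq_sum_single]
  refine Finset.sum_eq_zero fun i _ => ?_
  have h2 : HasDerivAt (fun τ : ℝ => formCoeff σ (torusExp
      (τ • (Pi.single i Complex.I : Fin n → ℂ)) • p)) (D (Pi.single i Complex.I)) 0 := by
    have h3 : HasDerivAt (fun τ : ℝ => τ • (Pi.single i Complex.I : Fin n → ℂ))
        ((1 : ℝ) • Pi.single i Complex.I) 0 := (hasDerivAt_id (0 : ℝ)).smul_const _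
    have h4 : HasFDerivAt (fun w : Fin n → ℂ => formCoeff σ (torusExp w • p))
        (D.restrictScalars ℝ) ((0 : ℝ) • (Pi.single i Complex.I : Fin n → ℂ)) := by
      rw [zero_smul]
      exact h1.restrictScalars ℝ
    have h5 := h4.comp_hasDerivAt (0 : ℝ) h3
    rw [one_smul] at h5
    exact h5
  have h6 : (fun τ : ℝ => formCoeff σ (torusExp
      (τ • (Pi.single i Complex.I : Fin n → ℂ)) • p)) = fun _ => formCoeff σ p := by
    funext τ
    apply formCoeff_smul_of_mem_realTorus hpres
    rw [torusExp_mem_realTorus_iff]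
    intro j
    by_cases hj : j = i
    · subst hj; simp
    · simp [hj]
  rw [h6] at h2
  have h7 : D (Pi.single i Complex.I) = 0 := h2.unique (hasDerivAt_const _ _)
  have h8 : (Pi.single i Complex.I : Fin n → ℂ) = Complex.I • Pi.single i 1 := by
    rw [← Pi.single_smul, smul_eq_mul, mul_one]
  rw [h8, map_smul, smul_eq_zero] at h7
  rw [h7.resolve_left Complex.I_ne_zero, smul_zero]

/-- If the coefficient is nonzero at one point, it is constant: where it is nonzero the vector
fields `X_j` span the tangent space, so its differential vanishes there. -/
theorem formCoeff_eq [ConnectedSpace N]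
    {σ : ∀ p : N, TangentSpace 𝓘(ℂ, Fin n → ℂ) p [⋀^Fin n]→L[ℂ] ℂ}
    (hσ : IsHolomorphicForm σ) (hpres : PreservesForm σ) {p : N} (hp : formCoeff σ p ≠ 0) (q : N) :
    formCoeff σ q = formCoeff σ p := by
  have hcont : Continuous (formCoeff σ) :=
    continuous_iff_continuousAt.2 fun q => (hasMFDerivAt_formCoeff hσ q).1
  have : IsManifold 𝓘(ℂ, Fin n → ℂ) 1 N := IsManifold.of_le (n := ω) le_top
  have hclopen : IsClopen {q | formCoeff σ q = formCoeff σ p} := by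
    refine ⟨isClosed_eq hcont continuous_const, isOpen_iff_mem_nhds.2 fun q hq => ?_⟩
    have hq0 : formCoeff σ q ≠ 0 := by rwa [show formCoeff σ q = formCoeff σ p from hq]
    have hev : ∀ᶠ r in 𝓝 q, HasMFDerivAt 𝓘(ℂ, Fin n → ℂ) 𝓘(ℂ, ℂ) (formCoeff σ) r 0 := by
      filter_upwards [hcont.continuousAt.eventually_ne hq0] with r hr
      refine (hasMFDerivAt_formCoeff hσ r).congr_model (ContinuousLinearMap.ext fun v => ?_)
      obtain ⟨ξ, rfl⟩ := infAction_surjective_of_injective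
        (infAction_injective_of_formCoeff_ne_zero hr) v
      exact modelDeriv_formCoeff_comp_infAction hσ hpres r ξ
    filter_upwards [eventually_eq_of_hasMFDerivAt_zero hev] with r hr
    exact hr.trans hq
  have h := hclopen.eq_univ ⟨p, rfl⟩
  exact (h ▸ Set.mem_univ q : q ∈ {q | formCoeff σ q = formCoeff σ p})

end FormCoefficient

/-! ### The moment map -/

section MomentMap

/-- The inclusion `ℝⁿ → ℂⁿ`. -/
noncomputable def ofRealVec {n : ℕ} : (Fin n → ℝ) →L[ℝ] (Fin n → ℂ) :=
  ContinuousLinearMap.pi fun i => Complex.ofRealCLM ∘L ContinuousLinearMap.proj i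

@[simp] theorem ofRealVec_apply {n : ℕ} (s : Fin n → ℝ) (i : Fin n) : ofRealVec s i = s i := rfl

theorem vec_eq_re_add_im {n : ℕ} (ξ : Fin n → ℂ) :
    ξ = ofRealVec (fun i => (ξ i).re) + Complex.I • ofRealVec (fun i => (ξ i).im) := by
  funext i
  simp [mul_comm Complex.I, Complex.re_add_im]

theorem torusExp_smul_I_smul_mem_realTorus {n : ℕ} (τ : ℝ) (s : Fin n → ℝ) :
    torusExp (τ • Complex.I • ofRealVec s) ∈ realTorus n := by
  rw [torusExp_mem_realTorus_iff]
  intro i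
  simp

theorem ContinuousAlternatingMap.apply_swap {V : Type*} [NormedAddCommGroup V]
    [NormedSpace ℝ V] (φ : V [⋀^Fin 2]→L[ℝ] ℝ) (v w : V) : φ ![v, w] = -φ ![w, v] := by
  have h := φ.toAlternatingMap.map_swap ![w, v] (i := 0) (j := 1) (by simp)
  have h2 : (![w, v] ∘ Equiv.swap (0 : Fin 2) 1) = ![v, w] := by
    funext i; fin_cases i <;> simp
  rw [h2] at h
  exact h

/-- The bilinear form underlying a real alternating 2-form. -/
noncomputable def ContinuousAlternatingMap.toBilin {V : Type*} [NormedAddCommGroup V]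
    [NormedSpace ℝ V] (φ : V [⋀^Fin 2]→L[ℝ] ℝ) : V →ₗ[ℝ] V →ₗ[ℝ] ℝ :=
  have hadd (v v' w : V) : φ ![v + v', w] = φ ![v, w] + φ ![v', w] :=
    φ.toAlternatingMap.map_vecCons_add ![w] v v'
  have hsmul (c : ℝ) (v w : V) : φ ![c • v, w] = c • φ ![v, w] :=
    φ.toAlternatingMap.map_vecCons_smul ![w] c v
  LinearMap.mk₂ ℝ (fun v w => φ ![v, w]) hadd hsmul
    (fun v w w' => by
      rw [φ.apply_swap v, hadd, neg_add, ← φ.apply_swap v, ← φ.apply_swap v])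
    (fun c v w => by rw [φ.apply_swap v, hsmul, ← smul_neg, ← φ.apply_swap v])

variable {n : ℕ} {N : Type*} [TopologicalSpace N] [ChartedSpace (Fin n → ℂ) N]

/-- The 2-form `κ` at `p` as a bilinear form on the model space. -/
noncomputable def formBilin (κ : ∀ p : N, TangentSpace 𝓘(ℂ, Fin n → ℂ) p [⋀^Fin 2]→L[ℝ] ℝ)
    (p : N) : (Fin n → ℂ) →ₗ[ℝ] (Fin n → ℂ) →ₗ[ℝ] ℝ :=
  (κ p : (Fin n → ℂ) [⋀^Fin 2]→L[ℝ] ℝ).toBilin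

theorem formBilin_swap (κ : ∀ p : N, TangentSpace 𝓘(ℂ, Fin n → ℂ) p [⋀^Fin 2]→L[ℝ] ℝ)
    (p : N) (v w : Fin n → ℂ) : formBilin κ p v w = -formBilin κ p w v :=
  ContinuousAlternatingMap.apply_swap _ v w

variable {κ : ∀ p : N, TangentSpace 𝓘(ℂ, Fin n → ℂ) p [⋀^Fin 2]→L[ℝ] ℝ}

theorem IsKahlerForm.formBilin_pos (hκ : IsKahlerForm κ) (p : N) {v : Fin n → ℂ} (hv : v ≠ 0) :
    0 < formBilin κ p v (Complex.I • v) :=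
  hκ.positive p v hv

theorem IsKahlerForm.formBilin_I (hκ : IsKahlerForm κ) (p : N) (v w : Fin n → ℂ) :
    formBilin κ p (Complex.I • v) (Complex.I • w) = formBilin κ p v w :=
  hκ.invariant p v w

variable [MulAction (ComplexTorus n) N] {μ : N → (Fin n → ℝ)}

theorem IsMomentMap.hasMFDerivAt (hμ : IsMomentMap κ μ) (p : N) :
    HasMFDerivAt 𝓘(ℝ, Fin n → ℂ) 𝓘(ℝ, Fin n → ℝ) μ p
      (modelDeriv ℝ μ p : (Fin n → ℂ) →L[ℝ] (Fin n → ℝ)) :=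
  (hμ.smooth.mdifferentiable (by simp) p).hasMFDerivAt_modelDeriv

variable [ContMDiffSMul 𝓘(ℂ, Fin n → ℂ) 𝓘(ℂ, Fin n → ℂ) ω (ComplexTorus n) N]

/-- Differentiation of a function along the flow `τ ↦ torusExp (τ • ξ) • p`. -/
theorem hasDerivAt_comp_flow {F : Type*} [NormedAddCommGroup F] [NormedSpace ℝ F] {g : N → F}
    {g' : (Fin n → ℂ) →L[ℝ] F} {p : N} {ξ : Fin n → ℂ} {τ : ℝ}
    (hg : HasMFDerivAt 𝓘(ℝ, Fin n → ℂ) 𝓘(ℝ, F) g (torusExp (τ • ξ) • p) g') :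
    HasDerivAt (fun τ : ℝ => g (torusExp (τ • ξ) • p))
      (g' (infAction (torusExp (τ • ξ) • p) ξ)) τ := by
  have h1 := (hg.comp_model (hasMFDerivAt_expOrbitMap p (τ • ξ)).complexToReal rfl
    fun _ => rfl).hasFDerivAt_model
  have h2 : HasDerivAt (fun τ : ℝ => τ • ξ) ((1 : ℝ) • ξ) τ := (hasDerivAt_id τ).smul_const ξ
  rw [one_smul] at h2
  exact h1.comp_hasDerivAt τ h2

theorem hasDerivAt_comp_flow_zero {F : Type*} [NormedAddCommGroup F] [NormedSpace ℝ F] {g : N → F}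
    {g' : (Fin n → ℂ) →L[ℝ] F} {p : N} {ξ : Fin n → ℂ}
    (hg : HasMFDerivAt 𝓘(ℝ, Fin n → ℂ) 𝓘(ℝ, F) g p g') :
    HasDerivAt (fun τ : ℝ => g (torusExp (τ • ξ) • p)) (g' (infAction p ξ)) 0 := by
  have h : torusExp ((0 : ℝ) • ξ) • p = p := by rw [zero_smul, torusExp_zero, one_smul]
  have := hasDerivAt_comp_flow (g := g) (g' := g') (p := p) (ξ := ξ) (τ := 0) (by rwa [h])
  rwa [h] at this

theorem IsMomentMap.formBilin_eq (hμ : IsMomentMap κ μ) (p : N) (s : Fin n → ℝ) (v : Fin n → ℂ) :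
    formBilin κ p (infAction p (Complex.I • ofRealVec s)) v =
      ∑ j, s j * (modelDeriv ℝ μ p : (Fin n → ℂ) →L[ℝ] (Fin n → ℝ)) v j := by
  have h1 : ∀ j, (modelDeriv ℝ μ p : (Fin n → ℂ) →L[ℝ] (Fin n → ℝ)) v j =
      formBilin κ p (infAction p (Pi.single j Complex.I)) v := by
    intro j
    rw [← inducedVectorField_eq]
    exact hμ.deriv_eq p v j
  have h2 : Complex.I • ofRealVec s = ∑ j, s j • (Pi.single j Complex.I : Fin n → ℂ) := by
    funext i
    simp [Finset.sum_apply, Pi.single_apply, mul_comm]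
  simp_rw [h1, h2]
  have h3 : infAction p (∑ j, s j • (Pi.single j Complex.I : Fin n → ℂ)) =
      ∑ j, s j • infAction p (Pi.single j Complex.I) := by
    rw [map_sum]
    exact Finset.sum_congr rfl fun j _ => (infAction (n := n) p).map_smul_of_tower (s j) _
  rw [h3, map_sum, LinearMap.sum_apply]
  simp

/-- The orbits of the real torus are isotropic. -/
theorem IsMomentMap.isotropic (hμ : IsMomentMap κ μ) (p : N) (s r : Fin n → ℝ) :
    formBilin κ p (infAction p (Complex.I • ofRealVec s)) (infAction p (Complex.I • ofRealVec r)) =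
      0 := by
  have h1 := hasDerivAt_comp_flow_zero (ξ := Complex.I • ofRealVec r) (hμ.hasMFDerivAt p)
  have h2 : (fun τ : ℝ => μ (torusExp (τ • Complex.I • ofRealVec r) • p)) = fun _ => μ p :=
    funext fun τ => hμ.invariant _ (torusExp_smul_I_smul_mem_realTorus τ r) p
  rw [h2] at h1
  rw [hμ.formBilin_eq, h1.unique (hasDerivAt_const _ _)]
  simp

/-- The kernel of the infinitesimal action at a point is the complexification of a real subspace:
the orbits of the real torus being isotropic, they are totally real. -/
theorem infAction_re_im_eq_zero (hκ : IsKahlerForm κ) (hμ : IsMomentMap κ μ) {p : N}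
    {ξ : Fin n → ℂ} (hξ : infAction p ξ = 0) :
    infAction p (ofRealVec fun i => (ξ i).re) = 0 ∧
      infAction p (ofRealVec fun i => (ξ i).im) = 0 := by
  set a := infAction p (ofRealVec fun i => (ξ i).re)
  set b := infAction p (ofRealVec fun i => (ξ i).im)
  have hab : a + Complex.I • b = 0 := by
    rw [← hξ]
    conv_rhs => rw [vec_eq_re_add_im ξ]
    rw [map_add, map_smul]
  have hiso : formBilin κ p a b = 0 := by
    have h := hμ.isotropic p (fun i => (ξ i).re) fun i => (ξ i).im
    rwa [(infAction p).map_smul, (infAction p).map_smul, hκ.formBilin_I] at h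
  have ha : a = -(Complex.I • b) := eq_neg_of_add_eq_zero_left hab
  have hb : b = 0 := by
    by_contra hb
    have hpos := hκ.formBilin_pos p hb
    rw [ha, map_neg, LinearMap.neg_apply, formBilin_swap, neg_neg] at hiso
    exact hpos.ne' hiso
  exact ⟨by rw [ha, hb, smul_zero, neg_zero], hb⟩

/-- The component of the moment map in the direction `s` strictly decreases along the noncompact
one-parameter subgroup `torusExp (τ • s)` of the complex torus. -/
theorem IsMomentMap.apply_torusExp_ne (hκ : IsKahlerForm κ) (hμ : IsMomentMap κ μ)
    (hinj : ∀ p : N, Function.Injective (infAction (n := n) p)) {s : Fin n → ℝ} (hs : s ≠ 0)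
    (p : N) : μ (torusExp (ofRealVec s) • p) ≠ μ p := by
  let h : ℝ → ℝ := fun τ => ∑ j, s j * μ (torusExp (τ • ofRealVec s) • p) j
  have hderiv : ∀ τ, ∃ h' < 0, HasDerivAt h h' τ := by
    intro τ
    set q := torusExp (τ • ofRealVec s) • p with hq
    set a := infAction q (ofRealVec s) with ha
    refine ⟨formBilin κ q (Complex.I • a) a, ?_, ?_⟩
    · rw [formBilin_swap, neg_lt_zero]
      apply hκ.formBilin_pos
      intro ha0
      apply hs
      have : ofRealVec s = 0 := hinj q (by rw [map_zero]; exact ha0)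
      funext i
      have := congrFun this i
      simpa using this
    · have h1 := hasDerivAt_comp_flow (hμ.hasMFDerivAt q)
      have h2 := hμ.formBilin_eq q s a
      rw [map_smul] at h2
      rw [h2]
      exact HasDerivAt.fun_sum fun j _ => ((hasDerivAt_pi.1 h1) j).const_mul (s j)
  have hanti : StrictAnti h := by
    apply strictAnti_of_deriv_neg
    intro τ
    obtain ⟨h', hneg, hd⟩ := hderiv τ
    rwa [hd.deriv]
  intro heq
  have := hanti (zero_lt_one)
  simp only [h, one_smul, zero_smul, torusExp_zero, heq, lt_irrefl] at this

end MomentMap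

/-! ### Real-valued holomorphic coefficients -/

section HolomorphicCoefficients

/-- A holomorphic function with real values is locally constant. -/
theorem eventually_eq_of_im_eq_zero {E : Type*} [NormedAddCommGroup E] [NormedSpace ℂ E]
    {f : E → ℂ} {x : E} (hf : ∀ᶠ y in 𝓝 x, DifferentiableAt ℂ f y)
    (him : ∀ᶠ y in 𝓝 x, (f y).im = 0) : ∀ᶠ y in 𝓝 x, f y = f x := by
  apply eventually_eq_of_hasMFDerivAt_zero (E := E) (F := ℂ)
  filter_upwards [hf, him.eventually_nhds] with y hy him
  have h1 : HasFDerivAt (fun y => (f y).im) (Complex.imCLM ∘L (fderiv ℂ f y).restrictScalars ℝ) y :=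
    Complex.imCLM.hasFDerivAt.comp y (hy.hasFDerivAt.restrictScalars ℝ)
  have h2 : Complex.imCLM ∘L (fderiv ℂ f y).restrictScalars ℝ = 0 :=
    h1.unique ((hasFDerivAt_const (0 : ℝ) y).congr_of_eventuallyEq him)
  have h3 : ∀ v, (fderiv ℂ f y v).im = 0 := fun v => congrArg (fun L : E →L[ℝ] ℝ => L v) h2
  have h4 : fderiv ℂ f y = 0 := by
    refine ContinuousLinearMap.ext fun v => Complex.ext ?_ (h3 v)
    have := h3 (Complex.I • v)
    simpa using this
  exact (hy.hasFDerivAt.congr_fderiv h4).hasMFDerivAt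

/-- A vector-valued function taking values in the image of a family of injective maps has
coefficients that depend on the parameter as regularly as the data. -/
theorem exists_contDiffAt_coefficients {E W F : Type*} [NormedAddCommGroup E] [NormedSpace ℂ E]
    [NormedAddCommGroup W] [NormedSpace ℂ W] [FiniteDimensional ℂ W]
    [NormedAddCommGroup F] [NormedSpace ℂ F] [FiniteDimensional ℂ F]
    {X : E → W →L[ℂ] F} {x : E → F} {y₀ : E} (hX : ContDiffAt ℂ ω X y₀) (hx : ContDiffAt ℂ ω x y₀)
    (hinj : Function.Injective (X y₀))
    (hmem : ∀ᶠ y in 𝓝 y₀, Function.Injective (X y) → ∃ c, X y c = x y) :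
    ∃ b : E → W, ContDiffAt ℂ ω b y₀ ∧
      ∀ᶠ y in 𝓝 y₀, Function.Injective (X y) ∧ X y (b y) = x y := by
  have : CompleteSpace W := FiniteDimensional.complete ℂ W
  obtain ⟨G₀, hG₀⟩ := LinearMap.exists_leftInverse_of_injective (X y₀ : W →ₗ[ℂ] F)
    (LinearMap.ker_eq_bot.2 hinj)
  let G : F →L[ℂ] W := LinearMap.toContinuousLinearMap G₀
  have hGX : G ∘L X y₀ = 1 :=
    ContinuousLinearMap.ext fun w => congrArg (fun L : W →ₗ[ℂ] W => L w) hG₀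
  have hM : ContDiffAt ℂ ω (fun y => G ∘L X y) y₀ := contDiffAt_const.clm_comp hX
  have hunit : ∀ᶠ y in 𝓝 y₀, IsUnit (G ∘L X y) := by
    have h1 : IsUnit (G ∘L X y₀) := by rw [hGX]; exact isUnit_one
    exact hM.continuousAt.eventually (Units.isOpen.mem_nhds h1)
  refine ⟨fun y => Ring.inverse (G ∘L X y) (G (x y)), ?_, ?_⟩
  · refine ContDiffAt.clm_apply ?_ (G.contDiff.contDiffAt.comp y₀ hx)
    have h2 : ContDiffAt ℂ ω Ring.inverse (G ∘L X y₀) := by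
      rw [hGX]
      exact contDiffAt_ringInverse ℂ (1 : (W →L[ℂ] W)ˣ)
    exact h2.comp y₀ hM
  · filter_upwards [hunit, hmem] with y hu hc
    have hinv : ∀ w, Ring.inverse (G ∘L X y) (G (X y w)) = w := fun w =>
      congrArg (fun L : W →L[ℂ] W => L w) (Ring.inverse_mul_cancel _ hu)
    have hi : Function.Injective (X y) := fun w w' hw => by rw [← hinv w, hw, hinv]
    obtain ⟨c, hc⟩ := hc hi
    exact ⟨hi, by rw [← hc, hinv]⟩

/-- A holomorphic family of endomorphisms of `ℂⁿ` whose kernels are complexifications of real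
subspaces: if the values on the basis vectors `e_i` with `i ∈ S` are independent, but the value on
`e_j` is a combination of them, then the coefficients of that combination are holomorphic and real,
so they are constant. -/
theorem exists_real_vector_of_mem_span {E : Type*} [NormedAddCommGroup E] [NormedSpace ℂ E] {n : ℕ}
    {A : E → (Fin n → ℂ) →L[ℂ] (Fin n → ℂ)} {y₀ : E} (hA : ContDiffAt ℂ ω A y₀)
    {S : Finset (Fin n)} {j : Fin n} (hj : j ∉ S)
    (hli : LinearIndependent ℂ fun i : S => A y₀ (Pi.single i.1 1))
    (hdep : ∀ᶠ y in 𝓝 y₀, LinearIndependent ℂ (fun i : S => A y (Pi.single i.1 1)) →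
      A y (Pi.single j 1) ∈ Submodule.span ℂ (Set.range fun i : S => A y (Pi.single i.1 1)))
    (hreal : ∀ᶠ y in 𝓝 y₀, ∀ ξ, A y ξ = 0 → A y (ofRealVec fun i => (ξ i).im) = 0) :
    ∃ s : Fin n → ℝ, s j = 1 ∧ ∀ᶠ y in 𝓝 y₀, A y (ofRealVec s) = 0 := by
  let inc : (S → ℂ) →L[ℂ] (Fin n → ℂ) := LinearMap.toContinuousLinearMap
    (Fintype.linearCombination ℂ fun i : S => (Pi.single i.1 1 : Fin n → ℂ))
  have hinc_apply : ∀ c, inc c = ∑ i, c i • (Pi.single i.1 1 : Fin n → ℂ) := fun _ => rfl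
  have hinc_j : ∀ c, inc c j = 0 := by
    intro c
    rw [hinc_apply, Finset.sum_apply]
    refine Finset.sum_eq_zero fun i _ => ?_
    have : j ≠ i.1 := fun h => hj (h ▸ i.2)
    simp [this]
  have hinc_im : ∀ c, (fun k => (inc c k).im) = fun k => (inc (fun i => ((c i).im : ℂ)) k).re := by
    intro c
    funext k
    simp only [hinc_apply, Finset.sum_apply, Pi.smul_apply, smul_eq_mul, Complex.im_sum,
      Complex.re_sum]
    refine Finset.sum_congr rfl fun i _ => ?_
    by_cases h : k = i.1
    · subst h; simp
    · simp [h]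
  have hcomp : ∀ y, (⇑(A y ∘L inc)) =
      Fintype.linearCombination ℂ fun i : S => A y (Pi.single i.1 1) := by
    intro y
    funext c
    simp [hinc_apply, Fintype.linearCombination_apply]
  have hinj : ∀ y, Function.Injective (A y ∘L inc) ↔
      LinearIndependent ℂ fun i : S => A y (Pi.single i.1 1) := by
    intro y
    rw [hcomp, ← linearIndependent_iff_injective_fintypeLinearCombination]
  obtain ⟨b, hb, hbev⟩ := exists_contDiffAt_coefficients (X := fun y => A y ∘L inc)
    (x := fun y => A y (Pi.single j 1)) (hA.clm_comp contDiffAt_const)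
    (hA.clm_apply contDiffAt_const) ((hinj y₀).2 hli) (by
      filter_upwards [hdep] with y hy hi
      have := hy ((hinj y).1 hi)
      rw [← Fintype.range_linearCombination] at this
      obtain ⟨c, hc⟩ := this
      exact ⟨c, (congrFun (hcomp y) c).trans hc⟩)
  -- The imaginary part of the relation `e_j - ∑ b_i e_i` is again a relation, among the `e_i` only.
  have hbim : ∀ᶠ y in 𝓝 y₀, ∀ i, (b y i).im = 0 := by
    filter_upwards [hbev, hreal] with y hy hr i
    have h1 : A y (Pi.single j 1 - inc (b y)) = 0 := by
      rw [map_sub, sub_eq_zero]; exact hy.2.symm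
    have h2 := hr _ h1
    have h3 : (ofRealVec fun k => ((Pi.single j 1 - inc (b y) : Fin n → ℂ) k).im) =
        -inc (fun i => ((b y i).im : ℂ)) := by
      funext k
      have h4 := congrFun (hinc_im (b y)) k
      have h5 : ((Pi.single j 1 : Fin n → ℂ) k).im = 0 := by
        by_cases h : k = j
        · subst h; simp
        · simp [h]
      have h6 : (inc (fun i => ((b y i).im : ℂ)) k).im = 0 := by
        simp only [hinc_apply, Finset.sum_apply, Pi.smul_apply, smul_eq_mul, Complex.im_sum]
        refine Finset.sum_eq_zero fun i _ => ?_
        by_cases h : k = i.1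
        · subst h; simp
        · simp [h]
      simp only [ofRealVec_apply, Pi.sub_apply, Complex.sub_im, h5, zero_sub, Pi.neg_apply]
      apply Complex.ext
      · simpa using h4
      · simp [h6]
    rw [h3, map_neg, neg_eq_zero] at h2
    have h7 := hy.1 (h2.trans (map_zero (A y ∘L inc)).symm)
    exact Complex.ofReal_eq_zero.1 (congrFun h7 i)
  have hbconst : ∀ᶠ y in 𝓝 y₀, b y = b y₀ := by
    have hd : ∀ᶠ y in 𝓝 y₀, DifferentiableAt ℂ b y := by
      filter_upwards [hb.eventually (by simp)] with y hy using hy.differentiableAt (by simp)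
    have : ∀ i, ∀ᶠ y in 𝓝 y₀, b y i = b y₀ i := by
      intro i
      refine eventually_eq_of_im_eq_zero (f := fun y => b y i) ?_ ?_
      · filter_upwards [hd] with y hy using (differentiableAt_pi.1 hy) i
      · filter_upwards [hbim] with y hy using hy i
    filter_upwards [eventually_all.2 this] with y hy using funext hy
  refine ⟨fun k => ((Pi.single j 1 - inc (b y₀) : Fin n → ℂ) k).re, by simp [hinc_j], ?_⟩
  filter_upwards [hbev, hbconst] with y hy hc
  have h1 : (ofRealVec fun k => ((Pi.single j 1 - inc (b y₀) : Fin n → ℂ) k).re) =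
      Pi.single j 1 - inc (b y₀) := by
    funext k
    have h2 : ((Pi.single j 1 - inc (b y₀) : Fin n → ℂ) k).im = 0 := by
      have h3 := congrFun (hinc_im (b y₀)) k
      have h4 : (fun i => ((b y₀ i).im : ℂ)) = 0 := by
        funext i; simp [hbim.self_of_nhds i]
      rw [h4, map_zero] at h3
      have h5 : ((Pi.single j 1 : Fin n → ℂ) k).im = 0 := by
        by_cases h : k = j
        · subst h; simp
        · simp [h]
      simpa [h5] using h3
    apply Complex.ext
    · simp
    · rw [h2]; simp
  rw [h1, map_sub, sub_eq_zero, ← hc]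
  exact hy.2.symm

end HolomorphicCoefficients

/-! ### Independence of the generating vector fields -/

section GenericFreeness

variable {n : ℕ} {N : Type*} [TopologicalSpace N] [ChartedSpace (Fin n → ℂ) N]

theorem isOpen_setOf_form_ne_zero [IsManifold 𝓘(ℂ, Fin n → ℂ) ω N]
    {σ : ∀ p : N, TangentSpace 𝓘(ℂ, Fin n → ℂ) p [⋀^Fin n]→L[ℂ] ℂ}
    (hσ : IsHolomorphicForm σ) : IsOpen {p | σ p ≠ 0} := by
  rw [isOpen_iff_mem_nhds]
  intro p hp
  set e := chartAt (Fin n → ℂ) p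
  have he : e ∈ atlas (Fin n → ℂ) N := chart_mem_atlas _ p
  have hpe : p ∈ e.source := mem_chart_source _ p
  let S : (Fin n → ℂ) → (Fin n → ℂ) [⋀^Fin n]→L[ℂ] ℂ := fun y =>
    (σ (e.symm y) : (Fin n → ℂ) [⋀^Fin n]→L[ℂ] ℂ).compContinuousLinearMap
      (modelDeriv ℂ e.symm y : (Fin n → ℂ) →L[ℂ] (Fin n → ℂ))
  have hS : ContinuousAt S (e p) :=
    ((hσ e he).contDiffAt (e.open_target.mem_nhds (e.map_source hpe))).continuousAt
  have hSp : S (e p) ≠ 0 := by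
    intro h0
    apply hp
    refine ContinuousAlternatingMap.ext fun v : Fin n → Fin n → ℂ => ?_
    have h1 := congrArg (fun φ : (Fin n → ℂ) [⋀^Fin n]→L[ℂ] ℂ =>
      φ fun i => (modelDeriv ℂ e p : (Fin n → ℂ) →L[ℂ] (Fin n → ℂ)) (v i)) h0
    have h2 : ∀ w : Fin n → ℂ, (modelDeriv ℂ e.symm (e p) : (Fin n → ℂ) →L[ℂ] (Fin n → ℂ))
        ((modelDeriv ℂ e p : (Fin n → ℂ) →L[ℂ] (Fin n → ℂ)) w) = w := fun w =>
      congrArg (fun L : (Fin n → ℂ) →L[ℂ] (Fin n → ℂ) => L w) (modelDeriv_symm_comp he hpe)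
    change (σ (e.symm (e p)) : (Fin n → ℂ) [⋀^Fin n]→L[ℂ] ℂ) (fun i =>
      (modelDeriv ℂ e.symm (e p) : (Fin n → ℂ) →L[ℂ] (Fin n → ℂ))
        ((modelDeriv ℂ e p : (Fin n → ℂ) →L[ℂ] (Fin n → ℂ)) (v i))) = 0 at h1
    simp_rw [h2] at h1
    rw [e.left_inv hpe] at h1
    exact h1
  filter_upwards [(e.continuousAt hpe).eventually (hS.eventually_ne hSp),
    e.open_source.mem_nhds hpe] with q hq hqe hq0
  apply hq
  change (σ (e.symm (e q)) : (Fin n → ℂ) [⋀^Fin n]→L[ℂ] ℂ).compContinuousLinearMap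
      (modelDeriv ℂ e.symm (e q) : (Fin n → ℂ) →L[ℂ] (Fin n → ℂ)) = 0
  rw [e.left_inv hqe, hq0]
  rfl

variable [MulAction (ComplexTorus n) N]

theorem linearDependent_of_formCoeff_eq_zero
    {σ : ∀ p : N, TangentSpace 𝓘(ℂ, Fin n → ℂ) p [⋀^Fin n]→L[ℂ] ℂ} {p : N} (hp : σ p ≠ 0)
    (h : formCoeff σ p = 0) :
    ¬ LinearIndependent ℂ fun i : Fin n => infAction (n := n) p (Pi.single i 1) := by
  intro hli
  let b : Module.Basis (Fin n) ℂ (Fin n → ℂ) :=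
    Module.Basis.mk hli (hli.span_eq_top_of_card_eq_finrank' (by simp)).ge
  have h1 := (AlternatingMap.map_basis_eq_zero_iff b
    (σ p : (Fin n → ℂ) [⋀^Fin n]→L[ℂ] ℂ).toAlternatingMap).1 (by
      rw [Module.Basis.coe_mk]
      exact h)
  exact hp (ContinuousAlternatingMap.toAlternatingMap_injective h1)

variable [ContMDiffSMul 𝓘(ℂ, Fin n → ℂ) 𝓘(ℂ, Fin n → ℂ) ω (ComplexTorus n) N]
  [IsManifold 𝓘(ℂ, Fin n → ℂ) ω N]

/-- Identity theorem for the vector fields generating the action. -/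
theorem infAction_apply_eq_zero_of_eventually [ConnectedSpace N] {p : N} {ξ : Fin n → ℂ}
    (h : ∀ᶠ q : N in 𝓝 p, infAction q ξ = 0) (q : N) : infAction q ξ = 0 := by
  let Z : Set N := {p | ∀ᶠ q : N in 𝓝 p, infAction q ξ = 0}
  have hclopen : IsClopen Z := by
    refine ⟨isClosed_of_closure_subset fun p hp => ?_, isOpen_iff_mem_nhds.2 fun p hp =>
      eventually_eventually_nhds.2 hp⟩
    set e := chartAt (Fin n → ℂ) p
    have he : e ∈ atlas (Fin n → ℂ) N := chart_mem_atlas _ p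
    have hpe : p ∈ e.source := mem_chart_source _ p
    obtain ⟨r, hr, hball⟩ := Metric.isOpen_iff.1 e.open_target (e p) (e.map_source hpe)
    have hnhds : ∀ᶠ q in 𝓝 p, q ∈ e.source ∧ e q ∈ Metric.ball (e p) r :=
      (e.open_source.eventually_mem hpe).and
        ((e.continuousAt hpe).eventually (Metric.ball_mem_nhds _ hr))
    obtain ⟨q₀, ⟨hq₀, hq₀r⟩, hq₀Z⟩ := mem_closure_iff_nhds.1 hp _ hnhds
    have han : AnalyticOnNhd ℂ (fun y => chartInfAction (N := N) e y ξ) (Metric.ball (e p) r) :=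
      fun y hy => ((contDiffAt_chartInfAction he (hball hy)).clm_apply
        contDiffAt_const).analyticAt
    have hev : (fun y => chartInfAction (N := N) e y ξ) =ᶠ[𝓝 (e q₀)] 0 := by
      have h1 : ∀ᶠ y in 𝓝 (e q₀), infAction (e.symm y) ξ = 0 := by
        have hcont := e.continuousAt_symm (e.map_source hq₀)
        rw [ContinuousAt, e.left_inv hq₀] at hcont
        exact hcont.eventually hq₀Z
      filter_upwards [h1, e.open_target.mem_nhds (e.map_source hq₀)] with y hy hyt
      have h2 := (chartInfAction_apply_eq_zero_iff he (e.map_target hyt) ξ).2 hy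
      rwa [e.right_inv hyt] at h2
    have hzero := han.eqOn_zero_of_preconnected_of_eventuallyEq_zero
      (convex_ball (e p) r).isPreconnected hq₀r hev
    filter_upwards [hnhds] with q hq
    exact (chartInfAction_apply_eq_zero_iff he hq.1 ξ).1 (hzero hq.2)
  have hZ := hclopen.eq_univ ⟨p, h⟩
  exact (show q ∈ Z by rw [hZ]; trivial : ∀ᶠ q : N in 𝓝 q, infAction q ξ = 0).self_of_nhds

/-- A vector field that vanishes identically generates a trivial flow. -/
theorem torusExp_smul_smul_eq_self [T2Space N] {ξ : Fin n → ℂ}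
    (h : ∀ q : N, infAction q ξ = 0) (ζ : ℂ) (p : N) : torusExp (ζ • ξ) • p = p := by
  have : IsManifold 𝓘(ℂ, Fin n → ℂ) 1 N := IsManifold.of_le (n := ω) le_top
  have hd : ∀ ζ : ℂ, HasMFDerivAt 𝓘(ℂ, ℂ) 𝓘(ℂ, Fin n → ℂ) (fun ζ : ℂ => torusExp (ζ • ξ) • p) ζ
      (0 : ℂ →L[ℂ] (Fin n → ℂ)) := by
    intro ζ
    have h1 : HasMFDerivAt 𝓘(ℂ, ℂ) 𝓘(ℂ, Fin n → ℂ) (fun ζ : ℂ => ζ • ξ) ζ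
        ((ContinuousLinearMap.id ℂ ℂ).smulRight ξ) :=
      ((hasFDerivAt_id ζ).smul_const ξ).hasMFDerivAt
    refine ((hasMFDerivAt_expOrbitMap p (ζ • ξ)).comp_model h1 rfl fun _ => rfl).congr_model ?_
    refine ContinuousLinearMap.ext fun v : ℂ => ?_
    change infAction (torusExp (ζ • ξ) • p) (v • ξ) = 0
    rw [map_smul, h, smul_zero]
  have h2 := eq_of_hasMFDerivAt_zero hd ζ 0
  rwa [zero_smul, torusExp_zero, one_smul] at h2

/-- On no open set are the vector fields `X_j` everywhere dependent: otherwise a fixed real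
combination of them, with a coefficient equal to one, would vanish on an open set, hence
everywhere, and a circle in the real torus would act trivially. -/
theorem exists_linearIndependent_infAction [T2Space N] [ConnectedSpace N]
    {κ : ∀ p : N, TangentSpace 𝓘(ℂ, Fin n → ℂ) p [⋀^Fin 2]→L[ℝ] ℝ} {μ : N → (Fin n → ℝ)}
    (hκ : IsKahlerForm κ) (hμ : IsMomentMap κ μ)
    (heff : ∀ t ∈ realTorus n, (∀ p : N, t • p = p) → t = 1) {U : Set N} (hU : IsOpen U)
    (hne : U.Nonempty) :
    ∃ p ∈ U, LinearIndependent ℂ fun i : Fin n => infAction (n := n) p (Pi.single i 1) := by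
  classical
  let P : Finset (Fin n) → Prop := fun S => ∃ p ∈ U,
    LinearIndependent ℂ fun i : S => infAction (n := n) p (Pi.single i.1 1)
  obtain ⟨p₀, hp₀⟩ := hne
  obtain ⟨S, hS⟩ : ∃ S, Maximal P S :=
    (Set.toFinite {S | P S}).exists_maximal ⟨∅, p₀, hp₀, linearIndependent_empty_type⟩
  obtain ⟨p, hpU, hli⟩ := hS.prop
  by_cases hSuniv : S = Finset.univ
  · subst hSuniv
    refine ⟨p, hpU, ?_⟩
    exact hli.comp (fun i : Fin n => (⟨i, Finset.mem_univ i⟩ : (Finset.univ : Finset (Fin n))))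
      fun i j h => congrArg Subtype.val h
  exfalso
  obtain ⟨j, hj⟩ : ∃ j, j ∉ S := by
    by_contra! h
    exact hSuniv (Finset.eq_univ_iff_forall.2 h)
  -- Adjoining `X_j` to the maximal subfamily makes it dependent at every point of `U`.
  have hmax : ¬ P (insert j S) := fun h =>
    hj (hS.le_of_ge h (Finset.subset_insert j S) (Finset.mem_insert_self j S))
  set e := chartAt (Fin n → ℂ) p
  have he : e ∈ atlas (Fin n → ℂ) N := chart_mem_atlas _ p
  have hpe : p ∈ e.source := mem_chart_source _ p
  have hnhds : ∀ᶠ y in 𝓝 (e p), y ∈ e.target ∧ e.symm y ∈ U := by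
    refine (e.open_target.eventually_mem (e.map_source hpe)).and ?_
    refine (e.continuousAt_symm (e.map_source hpe)).eventually ?_
    rw [e.left_inv hpe]
    exact hU.mem_nhds hpU
  have hA := contDiffAt_chartInfAction (N := N) he (e.map_source hpe)
  obtain ⟨s, hsj, hs⟩ := exists_real_vector_of_mem_span hA hj (by
      refine LinearIndependent.of_comp
        ((modelDeriv ℂ e.symm (e p) : (Fin n → ℂ) →L[ℂ] (Fin n → ℂ)) :
          (Fin n → ℂ) →ₗ[ℂ] (Fin n → ℂ)) ?_
      rw [infAction_eq_chart he hpe] at hli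
      exact hli) (by
      filter_upwards [hnhds] with y hy hliy
      by_contra hmem
      apply hmax
      refine ⟨e.symm y, hy.2, ?_⟩
      refine LinearIndependent.of_comp
        ((modelDeriv ℂ e (e.symm y) : (Fin n → ℂ) →L[ℂ] (Fin n → ℂ)) :
          (Fin n → ℂ) →ₗ[ℂ] (Fin n → ℂ)) ?_
      have h1 : LinearIndepOn ℂ (fun i => chartInfAction (N := N) e y (Pi.single i 1))
          (insert j (S : Set (Fin n))) := by
        rw [linearIndepOn_insert (by exact_mod_cast hj)]
        refine ⟨hliy, ?_⟩
        rw [Set.image_eq_range]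
        exact hmem
      have h2 := chartInfAction_eq he (e.map_target hy.1)
      rw [e.right_inv hy.1] at h2
      rw [h2, ← Finset.coe_insert] at h1
      exact h1) (by
      filter_upwards [hnhds] with y hy ξ hξ
      rw [← e.right_inv hy.1, chartInfAction_apply_eq_zero_iff he (e.map_target hy.1)] at hξ ⊢
      exact (infAction_re_im_eq_zero hκ hμ hξ).2)
  have hzero : ∀ q : N, infAction q (ofRealVec s) = 0 := by
    refine infAction_apply_eq_zero_of_eventually (p := p) ?_
    filter_upwards [(e.continuousAt hpe).eventually hs, e.open_source.mem_nhds hpe] with q hq hqe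
    exact (chartInfAction_apply_eq_zero_iff he hqe _).1 hq
  -- The time-`π` map acts trivially, but its `j`-th coordinate is `exp (i π) = -1`.
  have h1 := heff (torusExp ((Real.pi * Complex.I) • ofRealVec s))
    (torusExp_mem_realTorus_iff.2 fun i => by simp)
    (torusExp_smul_smul_eq_self hzero _)
  have h2 := congrArg (fun z : ComplexTorus n => (z : Fin n → ℂ) j) h1
  simp only [torusExp_apply, Pi.smul_apply, ofRealVec_apply, hsj, smul_eq_mul, Complex.ofReal_one,
    mul_one, Complex.exp_pi_mul_I, Units.val_one, Pi.one_apply] at h2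
  norm_num at h2

/-- The coefficient `σ(X₁, …, Xₙ)` vanishes nowhere: it is nonzero at some point, because the `X_j`
are somewhere independent on the open set where `σ` does not vanish, and it is constant. -/
theorem formCoeff_ne_zero [T2Space N] [ConnectedSpace N]
    {σ : ∀ p : N, TangentSpace 𝓘(ℂ, Fin n → ℂ) p [⋀^Fin n]→L[ℂ] ℂ}
    (hσ : IsHolomorphicForm σ) (hσ0 : ∃ p, σ p ≠ 0) (hpres : PreservesForm σ)
    {κ : ∀ p : N, TangentSpace 𝓘(ℂ, Fin n → ℂ) p [⋀^Fin 2]→L[ℝ] ℝ} {μ : N → (Fin n → ℝ)}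
    (hκ : IsKahlerForm κ) (hμ : IsMomentMap κ μ)
    (heff : ∀ t ∈ realTorus n, (∀ p : N, t • p = p) → t = 1) (p : N) : formCoeff σ p ≠ 0 := by
  obtain ⟨q, hq, hli⟩ :=
    exists_linearIndependent_infAction hκ hμ heff (isOpen_setOf_form_ne_zero hσ) hσ0
  have hq0 : formCoeff σ q ≠ 0 := fun h => linearDependent_of_formCoeff_eq_zero hq h hli
  rwa [formCoeff_eq hσ hpres hq0]

end GenericFreeness

/-! ### The orbit maps -/

section OrbitMap

variable {n : ℕ} {N : Type*} [TopologicalSpace N] [ChartedSpace (Fin n → ℂ) N]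
  [MulAction (ComplexTorus n) N]

/-- A top-degree form is determined by its value on the frame `X₁, …, Xₙ`. -/
theorem form_apply_infAction (σ : ∀ p : N, TangentSpace 𝓘(ℂ, Fin n → ℂ) p [⋀^Fin n]→L[ℂ] ℂ)
    (p : N) (v : Fin n → Fin n → ℂ) :
    (σ p : (Fin n → ℂ) [⋀^Fin n]→L[ℂ] ℂ) (fun i => infAction p (v i)) =
      formCoeff σ p * Matrix.det (Matrix.of v) := by
  let ψ : (Fin n → ℂ) [⋀^Fin n]→L[ℂ] ℂ :=
    (σ p : (Fin n → ℂ) [⋀^Fin n]→L[ℂ] ℂ).compContinuousLinearMap (infAction (n := n) p)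
  have h1 := AlternatingMap.eq_smul_basis_det (Pi.basisFun ℂ (Fin n)) ψ.toAlternatingMap
  have h2 := congrArg (fun φ : (Fin n → ℂ) [⋀^Fin n]→ₗ[ℂ] ℂ => φ v) h1
  have h3 : ψ.toAlternatingMap (Pi.basisFun ℂ (Fin n)) = formCoeff σ p := by
    change (σ p : (Fin n → ℂ) [⋀^Fin n]→L[ℂ] ℂ)
      (fun i => infAction p (Pi.basisFun ℂ (Fin n) i)) = _
    simp only [Pi.basisFun_apply]
    rfl
  rw [h3, Pi.basisFun_det] at h2
  exact h2

theorem torusForm_apply (z : ComplexTorus n) (v : Fin n → Fin n → ℂ) :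
    (torusForm n z : (Fin n → ℂ) [⋀^Fin n]→L[ℂ] ℂ) v =
      (∏ i, (z : Fin n → ℂ) i)⁻¹ * Matrix.det (Matrix.of v) := rfl

variable [ContMDiffSMul 𝓘(ℂ, Fin n → ℂ) 𝓘(ℂ, Fin n → ℂ) ω (ComplexTorus n) N]

theorem pullback_orbitMap (σ : ∀ p : N, TangentSpace 𝓘(ℂ, Fin n → ℂ) p [⋀^Fin n]→L[ℂ] ℂ)
    (p : N) (z : ComplexTorus n) :
    (σ (z • p)).compContinuousLinearMap
        (mfderiv 𝓘(ℂ, Fin n → ℂ) 𝓘(ℂ, Fin n → ℂ) (fun w : ComplexTorus n => w • p) z) =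
      formCoeff σ (z • p) • torusForm n z := by
  rw [(hasMFDerivAt_orbitMap z p).mfderiv]
  refine ContinuousAlternatingMap.ext fun v : Fin n → Fin n → ℂ => ?_
  change (σ (z • p) : (Fin n → ℂ) [⋀^Fin n]→L[ℂ] ℂ) (fun i => infAction (z • p)
      (((z⁻¹ : ComplexTorus n) : Fin n → ℂ) * v i)) =
    formCoeff σ (z • p) * (torusForm n z : (Fin n → ℂ) [⋀^Fin n]→L[ℂ] ℂ) v
  rw [form_apply_infAction, torusForm_apply]
  have h1 : Matrix.det (Matrix.of fun i => ((z⁻¹ : ComplexTorus n) : Fin n → ℂ) * v i) =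
      (∏ i, ((z⁻¹ : ComplexTorus n) : Fin n → ℂ) i) * Matrix.det (Matrix.of v) :=
    Matrix.det_mul_row _ (Matrix.of v)
  have h2 : (∏ i, ((z⁻¹ : ComplexTorus n) : Fin n → ℂ) i) = (∏ i, (z : Fin n → ℂ) i)⁻¹ := by
    rw [← Finset.prod_inv_distrib]
    refine Finset.prod_congr rfl fun i _ => eq_inv_of_mul_eq_one_left ?_
    exact congrFun z.inv_mul i
  rw [h1, h2]

variable [IsManifold 𝓘(ℂ, Fin n → ℂ) ω N]

/-- The inverse function theorem for the orbit map through `q`: a holomorphic logarithm of the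
group element moving `q` to a nearby point. -/
theorem exists_local_log {q : N} (hq : Function.Injective (infAction (n := n) q)) :
    ∃ ℓ : N → (Fin n → ℂ), ContMDiffAt 𝓘(ℂ, Fin n → ℂ) 𝓘(ℂ, Fin n → ℂ) ω ℓ q ∧
      ∀ᶠ q' in 𝓝 q, torusExp (ℓ q') • q = q' := by
  set e := chartAt (Fin n → ℂ) q
  have he : e ∈ atlas (Fin n → ℂ) N := chart_mem_atlas _ q
  have hqe : q ∈ e.source := mem_chart_source _ q
  have he' := IsManifold.subset_maximalAtlas (I := 𝓘(ℂ, Fin n → ℂ)) (n := ω) he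
  let F : (Fin n → ℂ) → (Fin n → ℂ) := fun w => e (torusExp w • q)
  have hF0 : F 0 = e q := by simp [F]
  have hF : ContDiffAt ℂ ω F 0 := by
    have h := (contDiffAt_chart_torusExp_smul he (e.map_source hqe)).comp (0 : Fin n → ℂ)
      ((contDiff_const.prodMk contDiff_id).contDiffAt :
        ContDiffAt ℂ ω (fun w : Fin n → ℂ => (e q, w)) 0)
    have h' : (fun x : (Fin n → ℂ) × (Fin n → ℂ) => e (torusExp x.2 • e.symm x.1)) ∘
        (fun w : Fin n → ℂ => (e q, w)) = F := by
      funext w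
      simp [F, e.left_inv hqe]
    rwa [h'] at h
  have hinj : Function.Injective (chartInfAction (N := N) e (e q)) := by
    rw [injective_iff_map_eq_zero]
    intro ξ hξ
    exact (injective_iff_map_eq_zero _).1 hq ξ ((chartInfAction_apply_eq_zero_iff he hqe ξ).1 hξ)
  let L : (Fin n → ℂ) ≃L[ℂ] (Fin n → ℂ) := (LinearEquiv.ofInjectiveEndo
    (chartInfAction (N := N) e (e q) : (Fin n → ℂ) →ₗ[ℂ] (Fin n → ℂ)) hinj).toContinuousLinearEquiv
  have hL : HasFDerivAt F (L : (Fin n → ℂ) →L[ℂ] (Fin n → ℂ)) 0 := by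
    refine (hF.differentiableAt (by simp)).hasFDerivAt.congr_fderiv ?_
    refine ContinuousLinearMap.ext fun v => ?_
    change fderiv ℂ F 0 v = chartInfAction e (e q) v
    rw [chartInfAction, e.left_inv hqe]
  let h := hF.toOpenPartialHomeomorph F hL (by simp)
  have hmem : e q ∈ h.target := by
    rw [← hF0]
    exact hF.image_mem_toOpenPartialHomeomorph_target hL (by simp)
  have hsymm : ContDiffAt ℂ ω h.symm (e q) := by
    rw [← hF0]
    exact hF.to_localInverse hL (by simp)
  have hsymm0 : h.symm (e q) = 0 := by
    rw [← hF0]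
    exact hF.localInverse_apply_image hL (by simp)
  have hℓ : ContMDiffAt 𝓘(ℂ, Fin n → ℂ) 𝓘(ℂ, Fin n → ℂ) ω (fun q' => h.symm (e q')) q :=
    hsymm.contMDiffAt.comp q (contMDiffAt_of_mem_maximalAtlas he' hqe)
  refine ⟨fun q' => h.symm (e q'), hℓ, ?_⟩
  have h1 : ∀ᶠ q' in 𝓝 q, torusExp (h.symm (e q')) • q ∈ e.source := by
    have hc : ContinuousAt (fun q' => torusExp (h.symm (e q')) • q) q :=
      ((contMDiff_expOrbitMap q).continuous.continuousAt).comp hℓ.continuousAt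
    refine hc.eventually_mem (e.open_source.mem_nhds ?_)
    rwa [hsymm0, torusExp_zero, one_smul]
  filter_upwards [h1, e.open_source.mem_nhds hqe,
    (e.continuousAt hqe).eventually_mem (h.open_target.mem_nhds hmem)] with q' h1 h2 h3
  exact e.injOn h1 h2 (h.right_inv h3)

/-- The action is transitive: orbits are open, so by connectedness there is only one. -/
theorem exists_smul_eq_of_injective [ConnectedSpace N]
    (hinj : ∀ p : N, Function.Injective (infAction (n := n) p)) (p q : N) :
    ∃ z : ComplexTorus n, z • p = q := by
  let O : Set N := {q | ∃ z : ComplexTorus n, z • p = q}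
  have hclopen : IsClopen O := by
    refine ⟨isClosed_of_closure_subset fun q hq => ?_, isOpen_iff_mem_nhds.2 fun q hq => ?_⟩
    · obtain ⟨ℓ, -, hℓ⟩ := exists_local_log (hinj q)
      obtain ⟨q', hq', z, hz⟩ := mem_closure_iff_nhds.1 hq _ hℓ
      refine ⟨(torusExp (ℓ q'))⁻¹ * z, ?_⟩
      rw [mul_smul, hz, inv_smul_eq_iff]
      exact hq'.symm
    · obtain ⟨ℓ, -, hℓ⟩ := exists_local_log (hinj q)
      obtain ⟨z, rfl⟩ := hq
      filter_upwards [hℓ] with q' hq'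
      exact ⟨torusExp (ℓ q') * z, by rw [mul_smul, hq']⟩
  have h := hclopen.eq_univ ⟨p, 1, one_smul _ p⟩
  exact (h ▸ Set.mem_univ q : q ∈ O)

/-- The action is free: by monotonicity of the moment map a stabilizer lies in the real torus, and
it acts trivially on the single orbit. -/
theorem eq_one_of_smul_eq_self [ConnectedSpace N]
    {κ : ∀ p : N, TangentSpace 𝓘(ℂ, Fin n → ℂ) p [⋀^Fin 2]→L[ℝ] ℝ} {μ : N → (Fin n → ℝ)}
    (hκ : IsKahlerForm κ) (hμ : IsMomentMap κ μ)
    (heff : ∀ t ∈ realTorus n, (∀ p : N, t • p = p) → t = 1)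
    (hinj : ∀ p : N, Function.Injective (infAction (n := n) p)) {z : ComplexTorus n} {p : N}
    (hz : z • p = p) : z = 1 := by
  apply heff
  · obtain ⟨w, rfl⟩ := torusExp_surjective z
    rw [torusExp_mem_realTorus_iff]
    by_contra hw
    have hre : (fun i => (w i).re) ≠ 0 := fun h => hw (congrFun h)
    apply hμ.apply_torusExp_ne hκ hinj hre p
    have h1 : torusExp (Complex.I • ofRealVec fun i => (w i).im) ∈ realTorus n := by
      rw [torusExp_mem_realTorus_iff]
      intro i
      simp
    rw [← hμ.invariant _ h1, smul_smul, ← torusExp_add, add_comm, ← vec_eq_re_add_im w, hz]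
  · intro q
    -- The stabilizers of all points agree, the group being commutative and the action transitive.
    obtain ⟨y, rfl⟩ := exists_smul_eq_of_injective hinj p q
    rw [smul_comm, hz]

theorem exists_diffeomorph_orbitMap [ConnectedSpace N]
    (hinj : ∀ p : N, Function.Injective (infAction (n := n) p))
    (hfree : ∀ (z : ComplexTorus n) (p : N), z • p = p → z = 1) (p : N) :
    ∃ Φ : Diffeomorph 𝓘(ℂ, Fin n → ℂ) 𝓘(ℂ, Fin n → ℂ) (ComplexTorus n) N ω,
      ∀ z, Φ z = z • p := by
  have hbij : Function.Bijective fun z : ComplexTorus n => z • p := by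
    refine ⟨fun z y hzy => ?_, exists_smul_eq_of_injective hinj p⟩
    have h : (y⁻¹ * z) • p = p := by
      rw [mul_smul, inv_smul_eq_iff]
      exact hzy
    exact (inv_mul_eq_one.1 (hfree _ _ h)).symm
  let Ψ := Equiv.ofBijective _ hbij
  refine ⟨⟨Ψ, contMDiff_orbitMap p, fun q => ?_⟩, fun _ => rfl⟩
  obtain ⟨z, rfl⟩ := Ψ.surjective q
  obtain ⟨ℓ, hℓ, hℓev⟩ := exists_local_log (hinj (Ψ z))
  have h1 : ContMDiffAt 𝓘(ℂ, Fin n → ℂ) 𝓘(ℂ, Fin n → ℂ) ω (fun q' => torusExp (ℓ q') * z)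
      (Ψ z) :=
    ContMDiffAt.mul (contMDiff_torusExp.contMDiffAt.comp _ hℓ) contMDiffAt_const
  refine h1.congr_of_eventuallyEq ?_
  filter_upwards [hℓev] with q' hq'
  change Ψ.symm q' = _
  rw [Equiv.symm_apply_eq]
  change q' = (torusExp (ℓ q') * z) • p
  rw [mul_smul]
  exact hq'.symm

end OrbitMap

/-! ### The special Lagrangian fibration -/

section Fibration

variable {n : ℕ} {N : Type*} [TopologicalSpace N] [ChartedSpace (Fin n → ℂ) N]
  [MulAction (ComplexTorus n) N]

/-- A smooth map to `ℝⁿ` that transforms under the complex torus by the logarithms of the absolute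
values of the coordinates, and whose fibres lie in single orbits of the real torus. -/
structure IsLogNormMap (π : N → (Fin n → ℝ)) : Prop where
  smooth : ContMDiff 𝓘(ℝ, Fin n → ℂ) 𝓘(ℝ, Fin n → ℝ) ∞ π
  equivariant : ∀ (w : Fin n → ℂ) (q : N), π (torusExp w • q) = π q + fun i => (w i).re
  fibre : ∀ q q' : N, π q = π q' → ∃ t ∈ realTorus n, t • q' = q

theorem exists_isLogNormMap (p : N)
    (Φ : Diffeomorph 𝓘(ℂ, Fin n → ℂ) 𝓘(ℂ, Fin n → ℂ) (ComplexTorus n) N ω)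
    (hΦ : ∀ z, Φ z = z • p) : ∃ π : N → (Fin n → ℝ), IsLogNormMap π := by
  have hsymm : ∀ (z : ComplexTorus n) (q : N), Φ.symm (z • q) = z * Φ.symm q := by
    intro z q
    obtain ⟨y, rfl⟩ := Φ.surjective q
    apply Φ.injective
    change Φ (Φ.symm (z • Φ y)) = Φ (z * Φ.symm (Φ y))
    rw [Φ.apply_symm_apply, Φ.symm_apply_apply, hΦ, hΦ, mul_smul]
  refine ⟨fun q i => Real.log ‖(Φ.symm q : Fin n → ℂ) i‖, ?_, ?_, ?_⟩
  · have h1 : ContMDiff 𝓘(ℝ, Fin n → ℂ) 𝓘(ℝ, Fin n → ℂ) ∞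
        (fun q => (Φ.symm q : Fin n → ℂ)) :=
      (Units.contMDiff_val.comp Φ.symm.contMDiff).complexToReal
    intro q
    have h2 : ContDiffAt ℝ ∞ (fun (x : Fin n → ℂ) i => Real.log ‖x i‖)
        (Φ.symm q : Fin n → ℂ) := by
      refine contDiffAt_pi.2 fun i => ?_
      have h0 := (Φ.symm q).apply_ne_zero i
      exact ((contDiffAt_apply ℝ ℂ i _).norm ℝ h0).log (norm_ne_zero_iff.2 h0)
    exact h2.contMDiffAt.comp q (h1 q)
  · intro w q
    funext i
    simp only [hsymm, Units.val_mul, Pi.mul_apply, torusExp_apply, norm_mul, Complex.norm_exp,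
      Pi.add_apply]
    rw [Real.log_mul (Real.exp_pos _).ne' (norm_ne_zero_iff.2 ((Φ.symm q).apply_ne_zero i)),
      Real.log_exp, add_comm]
  · intro q q' h
    refine ⟨Φ.symm q * (Φ.symm q')⁻¹, fun i => ?_, ?_⟩
    · have h1 := Real.log_injOn_pos
        (norm_pos_iff.2 ((Φ.symm q).apply_ne_zero i))
        (norm_pos_iff.2 ((Φ.symm q').apply_ne_zero i)) (congrFun h i)
      have h2 : (((Φ.symm q')⁻¹ : ComplexTorus n) : Fin n → ℂ) i *
          (Φ.symm q' : Fin n → ℂ) i = 1 := congrFun (Φ.symm q').inv_mul i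
      rw [Units.val_mul, Pi.mul_apply, norm_mul, h1, mul_comm, ← norm_mul, h2, norm_one]
    · apply Φ.symm.injective
      change Φ.symm ((Φ.symm q * (Φ.symm q')⁻¹) • q') = Φ.symm q
      rw [hsymm, inv_mul_cancel_right]

namespace IsLogNormMap

variable {π : N → (Fin n → ℝ)}

theorem eq_iff (hπ : IsLogNormMap π) (q q' : N) :
    π q = π q' ↔ q ∈ MulAction.orbit (realTorus n) q' := by
  constructor
  · intro h
    obtain ⟨t, ht, rfl⟩ := hπ.fibre q q' h
    exact ⟨⟨t, ht⟩, rfl⟩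
  · rintro ⟨⟨t, ht⟩, rfl⟩
    obtain ⟨w, rfl⟩ := torusExp_surjective t
    change π (torusExp w • q') = _
    rw [hπ.equivariant, show (fun i => (w i).re) = 0 from funext (torusExp_mem_realTorus_iff.1 ht),
      add_zero]

theorem apply_torusExp_ofRealVec (hπ : IsLogNormMap π) (s : Fin n → ℝ) (q : N) :
    π (torusExp (ofRealVec s) • q) = π q + s := by
  rw [hπ.equivariant]
  rfl

theorem hasMFDerivAt (hπ : IsLogNormMap π) (q : N) :
    HasMFDerivAt 𝓘(ℝ, Fin n → ℂ) 𝓘(ℝ, Fin n → ℝ) π q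
      (modelDeriv ℝ π q : (Fin n → ℂ) →L[ℝ] (Fin n → ℝ)) :=
  (hπ.smooth.mdifferentiable (by simp) q).hasMFDerivAt_modelDeriv

variable [ContMDiffSMul 𝓘(ℂ, Fin n → ℂ) 𝓘(ℂ, Fin n → ℂ) ω (ComplexTorus n) N]

theorem modelDeriv_infAction (hπ : IsLogNormMap π) (q : N) (ξ : Fin n → ℂ) :
    (modelDeriv ℝ π q : (Fin n → ℂ) →L[ℝ] (Fin n → ℝ)) (infAction q ξ) = fun i => (ξ i).re := by
  have h1 := hasDerivAt_comp_flow_zero (ξ := ξ) (hπ.hasMFDerivAt q)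
  have h2 : (fun τ : ℝ => π (torusExp (τ • ξ) • q)) =
      fun τ : ℝ => π q + τ • fun i => (ξ i).re := by
    funext τ
    rw [hπ.equivariant]
    congr 1
    funext i
    simp
  have h3 : HasDerivAt (fun τ : ℝ => π q + τ • fun i => (ξ i).re)
      ((1 : ℝ) • fun i => (ξ i).re) 0 := ((hasDerivAt_id (0 : ℝ)).smul_const _).const_add _
  rw [h2] at h1
  rw [h1.unique h3, one_smul]

/-- The noncompact subgroup `exp ℝⁿ` of the torus translates the base, so the fibration is globally
trivial. -/
theorem isSmoothFibration [Nonempty N] (hπ : IsLogNormMap π) : IsSmoothFibration n π where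
  smooth := hπ.smooth
  surjective := by
    intro b
    obtain ⟨p⟩ := ‹Nonempty N›
    exact ⟨torusExp (ofRealVec (b - π p)) • p, by
      rw [hπ.apply_torusExp_ofRealVec, add_sub_cancel]⟩
  locally_trivial := by
    intro b
    have hinv : ∀ (s s' : Fin n → ℝ) (q : N), s + s' = 0 →
        torusExp (ofRealVec s) • torusExp (ofRealVec s') • q = q := by
      intro s s' q h
      rw [smul_smul, ← torusExp_add, ← map_add, h, map_zero, torusExp_zero, one_smul]
    have hofReal : ContMDiff 𝓘(ℝ, Fin n → ℝ) 𝓘(ℝ, Fin n → ℂ) ∞ (ofRealVec (n := n)) :=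
      ofRealVec.contDiff.contMDiff
    have hsub : ContMDiff 𝓘(ℝ, Fin n → ℝ) 𝓘(ℝ, Fin n → ℝ) ∞ (fun c : Fin n → ℝ => c - b) :=
      (contDiff_id.sub contDiff_const).contMDiff
    have hsub' : ContMDiff 𝓘(ℝ, Fin n → ℝ) 𝓘(ℝ, Fin n → ℝ) ∞ (fun c : Fin n → ℝ => b - c) :=
      (contDiff_const.sub contDiff_id).contMDiff
    have hact := (contMDiff_torusExp_smul (n := n) (N := N)).complexToReal_prod
    refine ⟨Set.univ, fun q => torusExp (ofRealVec (b - π q)) • q,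
      fun x => torusExp (ofRealVec (x.1 - b)) • x.2, isOpen_univ, trivial, ?_, ?_, ?_, ?_⟩
    · exact (hact.comp ((hofReal.comp (hsub'.comp hπ.smooth)).prodMk contMDiff_id)).contMDiffOn
    · exact (hact.comp (((hofReal.comp (hsub.comp contMDiff_fst))).prodMk
        contMDiff_snd)).contMDiffOn
    · intro q _
      refine ⟨?_, hinv _ _ q (by abel)⟩
      rw [hπ.apply_torusExp_ofRealVec, add_sub_cancel]
    · intro c _ q hq
      have hq' : π q = b := hq
      have h1 : π (torusExp (ofRealVec (c - b)) • q) = c := by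
        rw [hπ.apply_torusExp_ofRealVec, hq', add_sub_cancel]
      refine ⟨h1, ?_⟩
      simp only [h1]
      exact hinv _ _ q (by abel)

/-- The tangent vectors of the real orbits come from the Lie algebra `i ℝⁿ` of the real torus. -/
theorem exists_of_mem_tangentVectors (hπ : IsLogNormMap π) {p₀ p : N}
    (hsurj : Function.Surjective (infAction (n := n) p)) {v : TangentSpace 𝓘(ℂ, Fin n → ℂ) p}
    (hv : v ∈ tangentVectors n (MulAction.orbit (realTorus n) p₀) p) :
    ∃ s : Fin n → ℝ, v = infAction p (Complex.I • ofRealVec s) := by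
  obtain ⟨γ, hγ, hγ0, hγL, hγv⟩ := hv
  obtain ⟨ξ, hξ⟩ := hsurj v
  have h1 := (hγ.mdifferentiable (by simp) 0).hasMFDerivAt_modelDeriv
  have h2 := ((hπ.hasMFDerivAt p).comp_model h1 hγ0 fun _ => rfl).hasFDerivAt_model
  have h3 : (fun t => π (γ t)) = fun _ => π p₀ := funext fun t => (hπ.eq_iff _ _).2 (hγL t)
  rw [h3] at h2
  have h4 := congrArg (fun L : ℝ →L[ℝ] (Fin n → ℝ) => L 1) (h2.unique (hasFDerivAt_const _ _))
  have h5 : (modelDeriv ℝ π p : (Fin n → ℂ) →L[ℝ] (Fin n → ℝ)) (infAction p ξ) = 0 := by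
    rw [hξ]
    refine Eq.trans ?_ h4
    exact congrArg (modelDeriv ℝ π p : (Fin n → ℂ) →L[ℝ] (Fin n → ℝ)) hγv.symm
  rw [hπ.modelDeriv_infAction] at h5
  refine ⟨fun i => (ξ i).im, hξ.symm.trans ?_⟩
  conv_lhs => rw [vec_eq_re_add_im ξ, h5, map_zero, zero_add]

/-- The orbits of the real torus are special Lagrangian for the phase that makes `e^{iθ} c iⁿ`
real, where `c` is the constant value of `σ(X₁, …, Xₙ)`. -/
theorem isSLag (hπ : IsLogNormMap π)
    {σ : ∀ p : N, TangentSpace 𝓘(ℂ, Fin n → ℂ) p [⋀^Fin n]→L[ℂ] ℂ}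
    {κ : ∀ p : N, TangentSpace 𝓘(ℂ, Fin n → ℂ) p [⋀^Fin 2]→L[ℝ] ℝ} {μ : N → (Fin n → ℝ)}
    (hμ : IsMomentMap κ μ)
    (hsurj : ∀ p : N, Function.Surjective (infAction (n := n) p)) {c : ℂ}
    (hc : ∀ p, formCoeff σ p = c) {θ : ℝ}
    (hθ : (Complex.exp (θ * Complex.I) * (c * Complex.I ^ n)).im = 0) (p₀ : N) :
    IsSLag n κ (fun p => Complex.exp (θ * Complex.I) • σ p)
      (MulAction.orbit (realTorus n) p₀) where
  submanifold := by
    intro p hp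
    refine ⟨Set.univ, π, isOpen_univ, trivial, hπ.smooth.contMDiffOn, fun q _ s => ?_, ?_⟩
    · refine ⟨infAction q (ofRealVec s), ?_⟩
      exact hπ.modelDeriv_infAction q (ofRealVec s)
    · ext q
      rw [← hπ.eq_iff] at hp
      simp [← hπ.eq_iff, hp]
  lagrangian := by
    intro p _ v hv w hw
    obtain ⟨s, rfl⟩ := hπ.exists_of_mem_tangentVectors (hsurj p) hv
    obtain ⟨r, rfl⟩ := hπ.exists_of_mem_tangentVectors (hsurj p) hw
    exact hμ.isotropic p s r
  special := by
    intro p _ v hv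
    choose s hs using fun i => hπ.exists_of_mem_tangentVectors (hsurj p) (hv i)
    obtain rfl : v = fun i => infAction p (Complex.I • ofRealVec (s i)) := funext hs
    have h1 : Matrix.det (Matrix.of fun i => Complex.I • ofRealVec (s i)) =
        Complex.I ^ n * (Matrix.det (Matrix.of s) : ℝ) := by
      have h2 : (Matrix.of fun i => Complex.I • ofRealVec (s i)) =
          Complex.I • Complex.ofRealHom.mapMatrix (Matrix.of s) := by
        ext i j
        simp
      rw [h2, Matrix.det_smul, Fintype.card_fin, ← RingHom.map_det]
      rfl
    change (Complex.exp (θ * Complex.I) * (σ p : (Fin n → ℂ) [⋀^Fin n]→L[ℂ] ℂ)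
      fun i => infAction p (Complex.I • ofRealVec (s i))).im = 0
    rw [form_apply_infAction, hc, h1, ← mul_assoc, ← mul_assoc, mul_assoc _ c,
      Complex.im_mul_ofReal, hθ, zero_mul]

end IsLogNormMap

theorem exists_phase (c : ℂ) : ∃ θ : ℝ, (Complex.exp (θ * Complex.I) * c).im = 0 := by
  refine ⟨-c.arg, ?_⟩
  have h : Complex.exp ((-c.arg : ℝ) * Complex.I) * c = ‖c‖ := by
    conv_lhs => rw [← Complex.norm_mul_exp_arg_mul_I c]
    rw [mul_left_comm, ← Complex.exp_add]
    simp
  rw [h, Complex.ofReal_im]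

end Fibration

theorem lemma2 (n : ℕ) (N : Type*) [TopologicalSpace N] [T2Space N] [ConnectedSpace N]
    [ChartedSpace (Fin n → ℂ) N] [IsManifold 𝓘(ℂ, Fin n → ℂ) ω N]
    (σ : ∀ p : N, TangentSpace 𝓘(ℂ, Fin n → ℂ) p [⋀^Fin n]→L[ℂ] ℂ)
    (hσ : IsHolomorphicForm σ) (hσ0 : ∃ p, σ p ≠ 0)
    (κ : ∀ p : N, TangentSpace 𝓘(ℂ, Fin n → ℂ) p [⋀^Fin 2]→L[ℝ] ℝ) (hκ : IsKahlerForm κ)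
    [MulAction (ComplexTorus n) N]
    [ContMDiffSMul 𝓘(ℂ, Fin n → ℂ) 𝓘(ℂ, Fin n → ℂ) ω (ComplexTorus n) N]
    (heff : ∀ t ∈ realTorus n, (∀ p : N, t • p = p) → t = 1)
    (hpres : PreservesForm σ) (hham : IsHamiltonian κ) :
    (∀ (z : ComplexTorus n) (p : N), z • p = p → z = 1) ∧
    (∀ p : N, ∃ Φ : Diffeomorph 𝓘(ℂ, Fin n → ℂ) 𝓘(ℂ, Fin n → ℂ) (ComplexTorus n) N ω,
      ∀ z, Φ z = z • p) ∧
    (∀ p : N, σ p ≠ 0) ∧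
    (∃ c : ℂ, c ≠ 0 ∧ ∀ (p : N) (z : ComplexTorus n),
      (σ (z • p)).compContinuousLinearMap
        (mfderiv 𝓘(ℂ, Fin n → ℂ) 𝓘(ℂ, Fin n → ℂ) (fun w : ComplexTorus n => w • p) z) =
      c • torusForm n z) ∧
    (∃ θ : ℝ, IsSLagFibration n κ (fun p => Complex.exp (θ * Complex.I) • σ p)
      {L | ∃ p : N, L = MulAction.orbit (realTorus n) p}) := by
  obtain ⟨μ, hμ⟩ := hham
  have hne : ∀ p, formCoeff σ p ≠ 0 := formCoeff_ne_zero hσ hσ0 hpres hκ hμ heff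
  have hinj : ∀ p : N, Function.Injective (infAction (n := n) p) := fun p =>
    infAction_injective_of_formCoeff_ne_zero (hne p)
  have hfree : ∀ (z : ComplexTorus n) (p : N), z • p = p → z = 1 := fun z p hz =>
    eq_one_of_smul_eq_self hκ hμ heff hinj hz
  have hdiffeo := exists_diffeomorph_orbitMap hinj hfree
  obtain ⟨p₀⟩ : Nonempty N := inferInstance
  have hconst : ∀ p, formCoeff σ p = formCoeff σ p₀ := formCoeff_eq hσ hpres (hne p₀)
  obtain ⟨Φ, hΦ⟩ := hdiffeo p₀
  obtain ⟨π, hπ⟩ := exists_isLogNormMap p₀ Φ hΦ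
  obtain ⟨θ, hθ⟩ := exists_phase (formCoeff σ p₀ * Complex.I ^ n)
  refine ⟨hfree, hdiffeo, fun p => ne_zero_of_formCoeff_ne_zero (hne p),
    ⟨formCoeff σ p₀, hne p₀, fun p z => ?_⟩, θ,
    ⟨Fin n → ℝ, inferInstance, inferInstance, inferInstance, inferInstance, inferInstance, π,
      hπ.isSmoothFibration, fun L => ?_⟩, ?_⟩
  · rw [pullback_orbitMap, hconst]
  · constructor
    · rintro ⟨p, rfl⟩
      exact ⟨π p, Set.ext fun q => (hπ.eq_iff q p).symm⟩
    · rintro ⟨b, rfl⟩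
      obtain ⟨p, rfl⟩ := hπ.isSmoothFibration.surjective b
      exact ⟨p, Set.ext fun q => hπ.eq_iff q p⟩
  · rintro L ⟨p, rfl⟩
    exact hπ.isSLag hμ (fun p => infAction_surjective_of_injective (hinj p)) hconst hθ p
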